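/- Let $\Gamma=(V,E)$ be a connected, locally finite graph (finite or infinite) without double edges, let $\mu_{xy}=\mu_{yx}\ge 0$ be edge weights with $\mu_{xy}>0$ exactly when $x\sim y$, i.e. $(x,y)\in E$, and let $\nu_x>0$ for $x\in V$. Let $X=(X_t)_{t\ge 0}$ be the continuous time random walk on $\Gamma$ with generator $\mathscr{L}f(x)=\frac1{\nu_x}\sum_{y}(f(y)-f(x))\mu_{xy}$ (the minimal process, sent to a cemetery if it explodes), and let $\mathbb{P}_x$ be its law started from $x$. Let $d_\nu$ be an adapted metric on $V$, i.e. a metric with $\frac1{\nu_x}\sum_y d_\nu(x,y)^2\mu_{xy}\le 1$ for all $x\in V$, and $d_\nu(x,y)\le 1$ whenever $x\sim y$. For $A\ge 1$, $\gamma>1$, a function $f:[0,\infty)\to[0,\infty)$ is called $(A,\gamma)$-regular on $[a,b)$ (with $b\le\infty$) if $f$ is non-decreasing on $[0,\infty)$ and $$\frac{f(\gamma s)}{f(s)}\le A\,\frac{f(\gamma t)}{f(t)}\qquad\text{for all } a\le s<t<\gamma^{-1}b$$ (read as $f(\gamma s)f(t)\le A f(\gamma t)f(s)$ where a denominator vanishes).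 Theorem. There are absolute constants $C_1,\theta>0$ such that the following holds for all $\Gamma,\mu,\nu,d_\nu$ as above. Let $x_1,x_2\in V$ and $f_1,f_2:[0,\infty)\to[0,\infty)$ satisfy $\mathbb{P}_{x_i}(X_t=x_i)\le 1/f_i(t)$ for $i=1,2$ and all $t\ge 0$ (with $1/0=\infty$). Let $A\ge1$, $\gamma>1$, $\delta\ge 1$, $0\le T_1<\infty$ and $T_2\le\infty$, and suppose that each $f_i$ is $(A,\gamma)$-regular on $[T_1,T_2)$ and satisfies $f_i(t)\le Ae^{\delta t}$ for all $t\in[T_1,T_2)$. Put $$\alpha=\min\{(2\gamma)^{-1},(64\delta)^{-1}\},\qquad \beta=\Big\lceil\frac{\log 2}{\log\gamma}\Big\rceil,\qquad \widetilde T_1=(8\alpha^{-2}T_1^2)\vee d_\nu(x_1,x_2).$$ Then, for all $t\in[\widetilde T_1,T_2)$, $$\mathbb{P}_{x_1}(X_t=x_2)\le\frac{C_1A^{\beta}(\nu_{x_2}/\nu_{x_1})^{1/2}}{\sqrt{f_1(\alpha t)f_2(\alpha t)}}\exp\Big(-\theta\,\frac{d_\nu(x_1,x_2)^2}{t}\Big),$$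 where the right-hand side is $\infty$ if $f_1(\alpha t)f_2(\alpha t)=0$, and $d_\nu(x_1,x_2)^2/t$ is read as $0$ if $t=0$. -/

import Mathlib

open MeasureTheory ProbabilityTheory Set
open scoped ENNReal

universe u

/-- A connected, locally finite weighted graph on the vertex set `V` with a positive vertex
weight. The edges are the pairs `(x, y)` with `μ x y > 0`; every other pair has weight `0`. -/
structure WeightedGraph (V : Type u) where
  /-- the edge weight -/
  μ : V → V → ℝ
  /-- the vertex weight -/
  ν : V → ℝ
  μ_symm : ∀ x y, μ x y = μ y x
  μ_nonneg : ∀ x y, 0 ≤ μ x y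
  ν_pos : ∀ x, 0 < ν x
  locallyFinite : ∀ x, {y | 0 < μ x y}.Finite
  connected : ∀ x y, Relation.ReflTransGen (fun a b => 0 < μ a b) x y

namespace WeightedGraph

variable {V : Type u} (Γ : WeightedGraph V)

/-- The finite set of neighbours of `x`. -/
noncomputable def nbrs (x : V) : Finset V := (Γ.locallyFinite x).toFinset

/-- The total edge weight `μ_x = ∑_y μ_{xy}` at `x`. -/
noncomputable def totalWeight (x : V) : ℝ := ∑ y ∈ Γ.nbrs x, Γ.μ x y

/-- The parameter `μ_x / ν_x` of the exponential holding time at `x`. -/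
noncomputable def rate (x : V) : ℝ := Γ.totalWeight x / Γ.ν x

/-- The law of the next vertex visited from `x`: the vertex `y` has probability `μ_{xy} / μ_x`.
If `x` has no neighbour (the graph is a single vertex), the walk stays at `x`. -/
noncomputable def jumpLaw [MeasurableSpace V] (x : V) : Measure V :=
  open Classical in
  if Γ.nbrs x = ∅ then Measure.dirac x
  else ∑ y ∈ Γ.nbrs x, ENNReal.ofReal (Γ.μ x y / Γ.totalWeight x) • Measure.dirac y

instance isProbabilityMeasure_jumpLaw [MeasurableSpace V] (x : V) :
    IsProbabilityMeasure (Γ.jumpLaw x) := by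
  unfold jumpLaw
  split_ifs with h
  · infer_instance
  · have hpos : ∀ y ∈ Γ.nbrs x, 0 < Γ.μ x y := fun y hy => by simpa [nbrs] using hy
    have htot : 0 < Γ.totalWeight x :=
      Finset.sum_pos hpos (Finset.nonempty_iff_ne_empty.mpr h)
    constructor
    simp only [Measure.finsetSum_apply, Measure.smul_apply, measure_univ, smul_eq_mul, mul_one]
    rw [← ENNReal.ofReal_sum_of_nonneg
      (fun y hy => div_nonneg (hpos y hy).le htot.le), ← Finset.sum_div]
    change ENNReal.ofReal (Γ.totalWeight x / Γ.totalWeight x) = 1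
    rw [div_self htot.ne', ENNReal.ofReal_one]

section Walk

variable [MeasurableSpace V] [DiscreteMeasurableSpace V]

/-- The one-step transition kernel of the jump chain. -/
noncomputable def jumpKernel : Kernel V V := ⟨Γ.jumpLaw, Measurable.of_discrete⟩

instance isMarkovKernel_jumpKernel : IsMarkovKernel Γ.jumpKernel :=
  ⟨fun x => Γ.isProbabilityMeasure_jumpLaw x⟩

/-- The law on `V^ℕ` of the jump chain `Y_0, Y_1, …` started from `x`: the Markov chain with
transition kernel `jumpKernel` and `Y_0 = x`. -/
noncomputable def chainLaw (x : V) : Measure (ℕ → V) :=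
  Kernel.trajMeasure (X := fun _ => V) (Measure.dirac x)
    (fun n => Γ.jumpKernel.comap (fun h : (i : Finset.Iic n) → V => h ⟨n, by simp⟩)
      (measurable_pi_apply _))

/-- The probability measure `P_x` on the sample space: the jump chain started from `x`, and,
independent of it, a sequence `E_0, E_1, …` of independent exponential variables of mean `1`. -/
noncomputable def P (x : V) : Measure ((ℕ → V) × (ℕ → ℝ)) :=
  (Γ.chainLaw x).prod (Measure.infinitePi fun _ : ℕ => expMeasure 1)

end Walk

/-- The time `∑_{k<n} E_k / rate (Y_k)` of the `n`-th jump; the `k`-th holding time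
`E_k / rate (Y_k)` is, given the jump chain, exponential with parameter `rate (Y_k)`
(and infinite if that parameter is `0`). -/
noncomputable def jumpTime (ω : (ℕ → V) × (ℕ → ℝ)) (n : ℕ) : ℝ≥0∞ :=
  ∑ k ∈ Finset.range n, ENNReal.ofReal (ω.2 k) / ENNReal.ofReal (Γ.rate (ω.1 k))

/-- The continuous time random walk: the minimal right-continuous Markov process
whose generator is `ℒ f(x) = ν_x⁻¹ ∑_y (f(y) - f(x)) μ_{xy}`. It sits at `Y_n` between the `n`-th
and the `(n+1)`-st jump time, and at the cemetery point `none` from the explosion time on. -/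
noncomputable def X (t : ℝ) (ω : (ℕ → V) × (ℕ → ℝ)) : Option V :=
  open Classical in
  if h : ∃ n, Γ.jumpTime ω n ≤ ENNReal.ofReal t ∧ ENNReal.ofReal t < Γ.jumpTime ω (n + 1)
  then some (ω.1 (Nat.find h)) else none

/-- The transition probability `P_x(X_t = y)`. -/
noncomputable def transProb [MeasurableSpace V] [DiscreteMeasurableSpace V]
    (t : ℝ) (x y : V) : ℝ≥0∞ :=
  Γ.P x {ω | Γ.X t ω = some y}

/-- The metric of `V` is an adapted metric of the weighted graph. -/
structure IsAdapted [MetricSpace V] : Prop where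
  sum_le_one : ∀ x, (1 / Γ.ν x) * ∑ y ∈ Γ.nbrs x, dist x y ^ 2 * Γ.μ x y ≤ 1
  dist_le_one : ∀ x y, 0 < Γ.μ x y → dist x y ≤ 1

end WeightedGraph

/-- `f : [0, ∞) → [0, ∞)` is `(A, γ)`-regular on `[a, b)`, where `b = ∞` is allowed: it is
non-decreasing on `[0, ∞)`, and `f (γ s) / f s ≤ A * f (γ t) / f t` for `a ≤ s < t < b / γ`.
The ratios are compared with the denominators cleared, so that `f 0 = 0` makes sense. -/
structure IsRegularOn (A γ : ℝ) (f : ℝ → ℝ) (a : ℝ) (b : EReal) : Prop where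
  monotoneOn : MonotoneOn f (Ici 0)
  ratio_le : ∀ s t : ℝ, a ≤ s → s < t → ((γ * t : ℝ) : EReal) < b →
    f (γ * s) * f t ≤ A * f (γ * t) * f s

/-- `α = min {(2γ)⁻¹, (64δ)⁻¹}`. -/
noncomputable def alphaConst (γ δ : ℝ) : ℝ := min (2 * γ)⁻¹ (64 * δ)⁻¹

/-- `β = ⌈log 2 / log γ⌉`. -/
noncomputable def betaConst (γ : ℝ) : ℕ := ⌈Real.log 2 / Real.log γ⌉₊

/-! All the analysis takes place on finite networks with killing, where the transition function is a
matrix exponential and no convergence question arises; the bounds obtained do not depend on the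
finite set.

The transfer to `V` rests on the decomposition at the last jump (`transProb_eq`). It makes the full
transition probabilities a supersolution of Duhamel's formula for the walk killed outside a finite
set `U`, and the killed kernel is the smallest one. Hence killing decreases transition
probabilities, and the killed walks inherit the on-diagonal hypotheses
(`ofReal_heat_killed_le_transProb`). Conversely, a walk that has made fewer than `N` jumps is still
in a finite set, so a bound uniform in `U` passes to the full walk
(`transProb_le_of_heat_killed_le`).

On a killed network, split the kernel at time `t / 2`. With `D` the distance of the two points,
every midpoint is at distance at least `D / 2` from one of them, so by Cauchy-Schwarz and
reversibility it suffices to bound the energy that each walk has at time `t / 2` beyond radius `R =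
D / 2` (`heat_le_sqrt_tailEnergy`).

That tail bound is `tailEnergy_mul_le`. Put `Z = R ^ 2 / t`. If `f t` exceeds `f (α * t)` by a
factor of order `exp (Z / 4608)`, the on-diagonal bound at time `t` already contains the Gaussian
factor. Otherwise regularity says that halving any earlier time costs at most `exp (Z / 4608)` in
`f`. Grigor'yan's iteration (`tailEnergy_le_sum`), driven by Davies' weighted estimate
(`KilledNetwork.energy_exp_le`), halves the time and shrinks the radius; its `k`-th step gains an
exponent proportional to `(9 / 8) ^ k * Z`, which beats the cost, linear in `k`. Jumps have size up
to `1`, so exponential weights of slope at most `1` are used and the iteration stops when the time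
is comparable to `R`. There the bound `exp (2 * s - 2 * R)` takes over, and the exponential growth
bound on `f` is used. -/

/-! ### Transition matrices of killed finite networks. -/

/-- A finite weighted network with killing: from `z` the walk moves to `w` at rate
`μ z w / ν z`, and the total rate of leaving `z` is `m z / ν z`. -/
structure KilledNetwork (ι : Type*) [Fintype ι] where
  /-- the edge weight -/
  μ : ι → ι → ℝ
  /-- the vertex weight -/
  ν : ι → ℝ
  /-- the total edge weight, killing included -/
  m : ι → ℝ
  μ_symm : ∀ z w, μ z w = μ w z
  μ_nonneg : ∀ z w, 0 ≤ μ z w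
  ν_pos : ∀ z, 0 < ν z
  sum_le : ∀ z, ∑ w, μ z w ≤ m z

namespace KilledNetwork

variable {ι : Type*} [Fintype ι] [DecidableEq ι] (N : KilledNetwork ι)

/-- The generator of the killed walk. -/
noncomputable def gen : Matrix ι ι ℝ :=
  Matrix.of fun z w => N.μ z w / N.ν z - if z = w then N.m z / N.ν z else 0

/-- The transition matrix of the killed walk at time `t`. -/
noncomputable def heat (t : ℝ) : Matrix ι ι ℝ := NormedSpace.exp (t • N.gen)

section Norm

open scoped Matrix.Norms.Operator

lemma heat_zero : N.heat 0 = 1 := by simp [heat]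

lemma heat_add (s t : ℝ) : N.heat (s + t) = N.heat s * N.heat t := by
  rw [heat, add_smul]
  exact Matrix.exp_add_of_commute _ _
    ((Commute.refl N.gen).smul_left s |>.smul_right t)

lemma hasDerivAt_heat_apply (t : ℝ) (x y : ι) :
    HasDerivAt (fun s => N.heat s x y) (∑ w, N.heat t x w * N.gen w y) t := by
  have h := hasDerivAt_exp_smul_const (𝕂 := ℝ) N.gen t
  exact (LinearMap.toContinuousLinearMap (Matrix.entryLinearMap ℝ ℝ x y)).hasFDerivAt.comp_hasDerivAt
    t h

/-- Reversibility of the killed walk with respect to `ν`. -/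
lemma heat_symm (t : ℝ) (x y : ι) : N.ν x * N.heat t x y = N.ν y * N.heat t y x := by
  have hU : IsUnit (Matrix.diagonal N.ν) := by
    rw [Matrix.isUnit_iff_isUnit_det, Matrix.det_diagonal]
    exact (Finset.prod_ne_zero_iff.2 fun i _ => (N.ν_pos i).ne').isUnit
  have hdet := (Matrix.isUnit_iff_isUnit_det _).1 hU
  have h1 : Matrix.diagonal N.ν * (t • N.gen) = (t • N.gen).transpose * Matrix.diagonal N.ν := by
    ext i j
    rw [Matrix.diagonal_mul, Matrix.mul_diagonal]
    simp only [Matrix.smul_apply, Matrix.transpose_apply, gen, Matrix.of_apply, smul_eq_mul]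
    have hi := (N.ν_pos i).ne'
    have hj := (N.ν_pos j).ne'
    rcases eq_or_ne i j with rfl | hij
    · ring
    · rw [if_neg hij, if_neg hij.symm, N.μ_symm i j]
      field_simp
      ring
  have h2 : (t • N.gen).transpose = Matrix.diagonal N.ν * (t • N.gen) * (Matrix.diagonal N.ν)⁻¹ := by
    rw [h1, Matrix.mul_assoc, Matrix.mul_nonsing_inv _ hdet, Matrix.mul_one]
  have h3 : (N.heat t).transpose * Matrix.diagonal N.ν = Matrix.diagonal N.ν * N.heat t := by
    rw [heat, ← Matrix.exp_transpose, h2, Matrix.exp_conj _ _ hU, Matrix.mul_assoc,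
      Matrix.nonsing_inv_mul _ hdet, Matrix.mul_one]
  have h4 := congrFun (congrFun h3 x) y
  rw [Matrix.diagonal_mul, Matrix.mul_diagonal, Matrix.transpose_apply] at h4
  rw [← h4, mul_comm]

/-- Uniformization: adding a large multiple of the identity makes every entry of the generator
nonnegative, hence also every term of the exponential series. The shift only changes the exponential
by a positive scalar. -/
lemma heat_nonneg {t : ℝ} (ht : 0 ≤ t) (x y : ι) : 0 ≤ N.heat t x y := by
  set c : ℝ := ∑ i, |N.m i / N.ν i|
  have hA : ∀ i j, 0 ≤ (t • (N.gen + c • (1 : Matrix ι ι ℝ))) i j := by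
    intro i j
    have h1 : |N.m i / N.ν i| ≤ c :=
      Finset.single_le_sum (f := fun i => |N.m i / N.ν i|) (fun i _ => abs_nonneg _)
        (Finset.mem_univ i)
    have h2 := (le_abs_self _).trans h1
    have h3 : 0 ≤ N.μ i j / N.ν i := div_nonneg (N.μ_nonneg i j) (N.ν_pos i).le
    refine mul_nonneg ht ?_
    simp only [Matrix.add_apply, gen, Matrix.of_apply, Matrix.smul_apply, Matrix.one_apply,
      smul_eq_mul]
    split_ifs <;> linarith
  set A := t • (N.gen + c • (1 : Matrix ι ι ℝ)) with hAdef
  have hpow : ∀ n i j, 0 ≤ (A ^ n) i j := by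
    intro n
    induction n with
    | zero => intro i j; rw [pow_zero, Matrix.one_apply]; split_ifs <;> simp
    | succ n ih =>
      intro i j
      rw [pow_succ, Matrix.mul_apply]
      exact Finset.sum_nonneg fun k _ => mul_nonneg (ih i k) (hA k j)
  have hexpA : 0 ≤ (NormedSpace.exp A) x y := by
    have h := NormedSpace.exp_series_hasSum_exp' (𝕂 := ℝ) A
    have h' := (LinearMap.toContinuousLinearMap (Matrix.entryLinearMap ℝ ℝ x y)).hasSum h
    refine h'.nonneg fun n => ?_
    exact mul_nonneg (by positivity) (hpow n x y)
  have hsplit : N.heat t = NormedSpace.exp A * NormedSpace.exp ((-(t * c)) • (1 : Matrix ι ι ℝ)) := by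
    rw [← Matrix.exp_add_of_commute _ _ ((Commute.one_right A).smul_right _), heat, hAdef]
    congr 1
    rw [smul_add, smul_smul, add_assoc, ← add_smul, add_neg_cancel, zero_smul, add_zero]
  have hone : NormedSpace.exp ((-(t * c)) • (1 : Matrix ι ι ℝ)) =
      Matrix.diagonal fun _ => Real.exp (-(t * c)) := by
    rw [Matrix.smul_one_eq_diagonal, Matrix.exp_diagonal]
    congr 1
    ext i
    rw [Pi.coe_exp, Real.exp_eq_exp_ℝ]
  rw [hsplit, hone, Matrix.mul_diagonal]
  exact mul_nonneg hexpA (Real.exp_pos _).le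

end Norm

lemma continuous_heat_apply (x y : ι) : Continuous fun t => N.heat t x y :=
  continuous_iff_continuousAt.2 fun t => (N.hasDerivAt_heat_apply t x y).continuousAt

/-- Duhamel's formula, for the time of the last jump. -/
lemma heat_apply_eq (t : ℝ) (x y : ι) :
    N.heat t x y = (if x = y then Real.exp (-(N.m y / N.ν y) * t) else 0) +
      ∑ z, N.μ z y / N.ν z *
        ∫ s in (0 : ℝ)..t, N.heat s x z * Real.exp (-(N.m y / N.ν y) * (t - s)) := by
  set q := N.m y / N.ν y
  -- The integrating factor `exp (q * s)` removes the diagonal term of the forward equation.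
  have hd : ∀ s ∈ uIcc 0 t, HasDerivAt (fun s => Real.exp (q * s) * N.heat s x y)
      (∑ z, N.μ z y / N.ν z * (N.heat s x z * Real.exp (q * s))) s := by
    intro s _
    have h1 : HasDerivAt (fun s => Real.exp (q * s)) (Real.exp (q * s) * (q * 1)) s :=
      ((hasDerivAt_id s).const_mul q).exp
    refine (h1.mul (N.hasDerivAt_heat_apply s x y)).congr_deriv ?_
    have h2 : ∑ w, N.heat s x w * N.gen w y =
        ∑ w, N.μ w y / N.ν w * N.heat s x w - q * N.heat s x y := by
      simp only [gen, Matrix.of_apply, mul_sub, Finset.sum_sub_distrib, mul_ite, mul_zero,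
        Finset.sum_ite_eq', Finset.mem_univ, if_true]
      rw [mul_comm q]
      simp only [mul_comm]
      rfl
    rw [h2, mul_one, mul_sub, Finset.mul_sum]
    simp only [mul_comm, mul_left_comm]
    ring_nf
  have hc : ∀ z, Continuous fun s => N.heat s x z * Real.exp (q * s) := fun z =>
    (N.continuous_heat_apply x z).mul (by fun_prop)
  have hi : IntervalIntegrable (fun s => ∑ z, N.μ z y / N.ν z * (N.heat s x z * Real.exp (q * s)))
      volume 0 t :=
    (continuous_finsetSum _ fun z _ => (hc z).const_mul _).intervalIntegrable _ _
  have hftc := intervalIntegral.integral_eq_sub_of_hasDerivAt hd hi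
  rw [intervalIntegral.integral_finsetSum
    (fun z _ => ((hc z).const_mul _).intervalIntegrable _ _)] at hftc
  simp only [intervalIntegral.integral_const_mul, heat_zero, Matrix.one_apply, mul_zero,
    Real.exp_zero, one_mul] at hftc
  have hpull : ∀ z, ∫ s in (0 : ℝ)..t, N.heat s x z * Real.exp (-q * (t - s)) =
      Real.exp (-q * t) * ∫ s in (0 : ℝ)..t, N.heat s x z * Real.exp (q * s) := by
    intro z
    rw [← intervalIntegral.integral_const_mul]
    congr 1
    ext s
    rw [show -q * (t - s) = -q * t + q * s by ring, Real.exp_add]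
    ring
  simp only [hpull]
  have hsum : ∑ z, N.μ z y / N.ν z * (Real.exp (-q * t) *
      ∫ s in (0 : ℝ)..t, N.heat s x z * Real.exp (q * s)) = Real.exp (-q * t) *
      ∑ z, N.μ z y / N.ν z * ∫ s in (0 : ℝ)..t, N.heat s x z * Real.exp (q * s) := by
    rw [Finset.mul_sum]
    exact Finset.sum_congr rfl fun z _ => by ring
  rw [hsum, hftc, mul_sub, ← mul_assoc, ← Real.exp_add, show -q * t + q * t = 0 by ring,
    Real.exp_zero]
  split_ifs <;> ring

/-! ### Davies' weighted energy estimate. -/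

/-- The energy at time `s` of the walk started from `x`, with weight `w`. -/
noncomputable def energy (x : ι) (w : ι → ℝ) (s : ℝ) : ℝ :=
  ∑ z, N.heat s x z ^ 2 * w z * (N.ν x / N.ν z)

-- Symmetry of `μ` replaces the exponential by `cosh`, which has no linear term, so that `cosh a ≤ 1
-- + a ^ 2` for `|a| ≤ 1` leaves an error of second order only. The products `v z * v w` are then
-- decoupled by the inequality between arithmetic and geometric means. The term with `N.m` is the
-- one that the diagonal of the generator cancels.
omit [DecidableEq ι] in
lemma sum_quadratic_le {ψ : ι → ℝ} {c : ℝ} (hψ : ∀ z w, 0 < N.μ z w → |ψ z - ψ w| ≤ 1)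
    (hc : ∀ z, ∑ w, (ψ z - ψ w) ^ 2 * N.μ z w ≤ c * N.ν z) (v : ι → ℝ) :
    ∑ z, ∑ w, 2 * (v z * v w * Real.exp (ψ z - ψ w) * N.μ z w) ≤
      ∑ z, 2 * (v z ^ 2 * (N.m z + c * N.ν z)) := by
  have hswap : ∑ z, ∑ w, v z * v w * Real.exp (ψ z - ψ w) * N.μ z w =
      ∑ z, ∑ w, v z * v w * Real.exp (-(ψ z - ψ w)) * N.μ z w := by
    rw [Finset.sum_comm]
    refine Finset.sum_congr rfl fun z _ => Finset.sum_congr rfl fun w _ => ?_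
    rw [N.μ_symm w z, neg_sub, mul_comm (v w)]
  have hswap2 : ∑ z, ∑ w, v w ^ 2 * (1 + (ψ z - ψ w) ^ 2) * N.μ z w =
      ∑ z, ∑ w, v z ^ 2 * (1 + (ψ z - ψ w) ^ 2) * N.μ z w := by
    rw [Finset.sum_comm]
    refine Finset.sum_congr rfl fun z _ => Finset.sum_congr rfl fun w _ => ?_
    rw [N.μ_symm w z]
    ring
  calc ∑ z, ∑ w, 2 * (v z * v w * Real.exp (ψ z - ψ w) * N.μ z w)
      = ∑ z, ∑ w, 2 * (v z * v w * Real.cosh (ψ z - ψ w) * N.μ z w) := by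
        simp only [← Finset.mul_sum]
        rw [two_mul]
        nth_rewrite 2 [hswap]
        simp only [Real.cosh_eq, ← Finset.sum_add_distrib, Finset.mul_sum]
        refine Finset.sum_congr rfl fun z _ => Finset.sum_congr rfl fun w _ => ?_
        ring
    _ ≤ ∑ z, ∑ w, (v z ^ 2 * (1 + (ψ z - ψ w) ^ 2) * N.μ z w +
          v w ^ 2 * (1 + (ψ z - ψ w) ^ 2) * N.μ z w) := by
        refine Finset.sum_le_sum fun z _ => Finset.sum_le_sum fun w _ => ?_
        rcases (N.μ_nonneg z w).eq_or_lt with h0 | hpos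
        · simp [← h0]
        set a := ψ z - ψ w
        have ha : a ^ 2 ≤ 1 := (sq_le_one_iff_abs_le_one a).2 (hψ z w hpos)
        have h1 : Real.cosh a ≤ 1 + a ^ 2 := by
          have h2 := Real.cosh_le_exp_half_sq a
          have h3 := Real.exp_bound_div_one_sub_of_interval (x := a ^ 2 / 2) (by positivity)
            (by linarith)
          have h4 : 1 / (1 - a ^ 2 / 2) ≤ 1 + a ^ 2 := by
            rw [div_le_iff₀ (by linarith)]
            nlinarith [sq_nonneg a]
          linarith
        have h5 : 2 * (v z * v w * Real.cosh a) ≤ (v z ^ 2 + v w ^ 2) * Real.cosh a := by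
          nlinarith [sq_nonneg (v z - v w), Real.cosh_pos a]
        have h6 : (v z ^ 2 + v w ^ 2) * Real.cosh a ≤ (v z ^ 2 + v w ^ 2) * (1 + a ^ 2) :=
          mul_le_mul_of_nonneg_left h1 (by positivity)
        nlinarith [h5.trans h6]
    _ = ∑ z, ∑ w, 2 * (v z ^ 2 * (1 + (ψ z - ψ w) ^ 2) * N.μ z w) := by
        simp only [Finset.sum_add_distrib, hswap2, ← two_mul, ← Finset.mul_sum]
    _ ≤ ∑ z, 2 * (v z ^ 2 * (N.m z + c * N.ν z)) := by
        refine Finset.sum_le_sum fun z _ => ?_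
        rw [← Finset.mul_sum]
        refine mul_le_mul_of_nonneg_left ?_ zero_le_two
        have h : ∑ w, v z ^ 2 * (1 + (ψ z - ψ w) ^ 2) * N.μ z w =
            v z ^ 2 * (∑ w, N.μ z w + ∑ w, (ψ z - ψ w) ^ 2 * N.μ z w) := by
          rw [← Finset.sum_add_distrib, Finset.mul_sum]
          exact Finset.sum_congr rfl fun w _ => by ring
        rw [h]
        exact mul_le_mul_of_nonneg_left (add_le_add (N.sum_le z) (hc z)) (sq_nonneg _)

/-- Davies' integral estimate: the exponentially weighted energy grows at rate at most `2 * c`. -/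
lemma energy_exp_le {ψ : ι → ℝ} {c : ℝ} (hψ : ∀ z w, 0 < N.μ z w → |ψ z - ψ w| ≤ 1)
    (hc : ∀ z, ∑ w, (ψ z - ψ w) ^ 2 * N.μ z w ≤ c * N.ν z) (x : ι) {τ s : ℝ} (hτs : τ ≤ s) :
    N.energy x (fun z => Real.exp (2 * ψ z)) s ≤
      Real.exp (2 * c * (s - τ)) * N.energy x (fun z => Real.exp (2 * ψ z)) τ := by
  set Φ := N.energy x (fun z => Real.exp (2 * ψ z)) with hΦ
  have hder : ∀ s, HasDerivAt Φ (∑ z, 2 * N.heat s x z * (∑ w, N.heat s x w * N.gen w z) *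
      Real.exp (2 * ψ z) * (N.ν x / N.ν z)) s := by
    intro s
    have : ∀ z ∈ Finset.univ, HasDerivAt (fun s => N.heat s x z ^ 2 * Real.exp (2 * ψ z) *
        (N.ν x / N.ν z)) (2 * N.heat s x z * (∑ w, N.heat s x w * N.gen w z) *
      Real.exp (2 * ψ z) * (N.ν x / N.ν z)) s := fun z _ => by
      have h := (((N.hasDerivAt_heat_apply s x z).pow 2).mul_const (Real.exp (2 * ψ z))).mul_const
        (N.ν x / N.ν z)
      refine h.congr_deriv ?_
      norm_num
    exact HasDerivAt.fun_sum this
  have hle : ∀ s, ∑ z, 2 * N.heat s x z * (∑ w, N.heat s x w * N.gen w z) *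
      Real.exp (2 * ψ z) * (N.ν x / N.ν z) ≤ 2 * c * Φ s := by
    intro s
    -- Distributing the weight `exp (2 * ψ)` evenly over the two factors of the energy turns its
    -- derivative into the quadratic form of `sum_quadratic_le`.
    set v : ι → ℝ := fun z => Real.exp (ψ z) * (N.heat s x z / N.ν z)
    have h := N.sum_quadratic_le hψ hc v
    have hexp : ∀ a b, Real.exp (2 * ψ a) = Real.exp (ψ a) * Real.exp (ψ b) *
        Real.exp (ψ a - ψ b) := fun a b => by
      rw [← Real.exp_add, ← Real.exp_add]; ring_nf
    have h1 : ∀ z, 2 * N.heat s x z * (∑ w, N.heat s x w * N.gen w z) *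
        Real.exp (2 * ψ z) * (N.ν x / N.ν z) = N.ν x *
        (∑ w, 2 * (v z * v w * Real.exp (ψ z - ψ w) * N.μ z w) - 2 * (v z ^ 2 * N.m z)) := by
      intro z
      have h2 : ∑ w, N.heat s x w * N.gen w z =
          ∑ w, N.heat s x w * (N.μ w z / N.ν w) - N.heat s x z * (N.m z / N.ν z) := by
        simp only [gen, Matrix.of_apply, mul_sub, Finset.sum_sub_distrib, mul_ite, mul_zero,
          Finset.sum_ite_eq', Finset.mem_univ, if_true]
      have h3 : ∀ w, 2 * (v z * v w * Real.exp (ψ z - ψ w) * N.μ z w) =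
          2 * (N.heat s x z / N.ν z) * Real.exp (2 * ψ z) * (N.heat s x w * (N.μ w z / N.ν w)) := by
        intro w
        rw [hexp z w, N.μ_symm w z]
        ring
      have h4 : v z ^ 2 = Real.exp (2 * ψ z) * (N.heat s x z / N.ν z) ^ 2 := by
        rw [hexp z z, sub_self, Real.exp_zero]
        ring
      rw [h2, h4, Finset.sum_congr rfl fun w _ => h3 w, ← Finset.mul_sum]
      ring
    have h5 : Φ s = N.ν x * ∑ z, v z ^ 2 * N.ν z := by
      rw [hΦ, energy, Finset.mul_sum]
      refine Finset.sum_congr rfl fun z _ => ?_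
      have h4 : v z ^ 2 = Real.exp (2 * ψ z) * (N.heat s x z / N.ν z) ^ 2 := by
        rw [hexp z z, sub_self, Real.exp_zero]
        ring
      have := (N.ν_pos z).ne'
      rw [h4]
      field_simp
    rw [Finset.sum_congr rfl fun z _ => h1 z, ← Finset.mul_sum, h5, mul_left_comm]
    refine mul_le_mul_of_nonneg_left ?_ (N.ν_pos x).le
    rw [Finset.sum_sub_distrib]
    have h6 : ∑ z, 2 * (v z ^ 2 * (N.m z + c * N.ν z)) =
        ∑ z, 2 * (v z ^ 2 * N.m z) + 2 * c * ∑ z, v z ^ 2 * N.ν z := by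
      rw [Finset.mul_sum, ← Finset.sum_add_distrib]
      exact Finset.sum_congr rfl fun z _ => by ring
    linarith
  have hanti : Antitone fun s => Real.exp (-(2 * c) * s) * Φ s := by
    refine antitone_of_hasDerivAt_nonpos (f' := fun s => Real.exp (-(2 * c) * s) *
      (-(2 * c)) * Φ s + Real.exp (-(2 * c) * s) * (∑ z, 2 * N.heat s x z *
      (∑ w, N.heat s x w * N.gen w z) * Real.exp (2 * ψ z) * (N.ν x / N.ν z))) (fun s => ?_)
      (fun s => ?_)
    · have h1 : HasDerivAt (fun s => Real.exp (-(2 * c) * s))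
          (Real.exp (-(2 * c) * s) * (-(2 * c) * 1)) s := ((hasDerivAt_id s).const_mul _).exp
      rw [mul_one] at h1
      exact h1.mul (hder s)
    · change _ ≤ (0 : ℝ)
      have := mul_le_mul_of_nonneg_left (hle s) (Real.exp_pos (-(2 * c) * s)).le
      linarith
  have h := mul_le_mul_of_nonneg_left (hanti hτs) (Real.exp_pos (2 * c * s)).le
  rw [← mul_assoc, ← mul_assoc, ← Real.exp_add, ← Real.exp_add] at h
  rw [show 2 * c * s + -(2 * c) * s = 0 by ring, Real.exp_zero, one_mul] at h
  rwa [show 2 * c * (s - τ) = 2 * c * s + -(2 * c) * τ by ring]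

end KilledNetwork

/-! ### Tail energies and Grigor'yan's iteration. -/

namespace KilledNetwork

variable {ι : Type*} [Fintype ι] [DecidableEq ι] (N : KilledNetwork ι)

/-- The energy at time `s` of the walk started from `x`, outside the ball `{ρ < R}`. -/
noncomputable def tailEnergy (x : ι) (ρ : ι → ℝ) (R s : ℝ) : ℝ :=
  N.energy x (fun z => if R ≤ ρ z then 1 else 0) s

/-- The function `ρ` is `1`-Lipschitz in the sense of adapted metrics. -/
structure IsAdaptedFun (ρ : ι → ℝ) : Prop where
  abs_sub_le : ∀ z w, 0 < N.μ z w → |ρ z - ρ w| ≤ 1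
  sum_le : ∀ z, ∑ w, (ρ z - ρ w) ^ 2 * N.μ z w ≤ N.ν z

variable {N}

lemma energy_mono (x : ι) {w w' : ι → ℝ} (h : ∀ z, w z ≤ w' z) (s : ℝ) :
    N.energy x w s ≤ N.energy x w' s := by
  refine Finset.sum_le_sum fun z _ => ?_
  have h1 : 0 ≤ N.ν x / N.ν z := div_nonneg (N.ν_pos x).le (N.ν_pos z).le
  exact mul_le_mul_of_nonneg_right (mul_le_mul_of_nonneg_left (h z) (sq_nonneg _)) h1

lemma energy_add (x : ι) (w w' : ι → ℝ) (s : ℝ) :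
    N.energy x (fun z => w z + w' z) s = N.energy x w s + N.energy x w' s := by
  simp only [energy, ← Finset.sum_add_distrib]
  exact Finset.sum_congr rfl fun z _ => by ring

lemma energy_const_mul (x : ι) (a : ℝ) (w : ι → ℝ) (s : ℝ) :
    N.energy x (fun z => a * w z) s = a * N.energy x w s := by
  simp only [energy, Finset.mul_sum]
  exact Finset.sum_congr rfl fun z _ => by ring

/-- The semigroup property at the midpoint, with the second factor reversed by symmetry. -/
lemma energy_one (x : ι) (s : ℝ) : N.energy x (fun _ => 1) s = N.heat (2 * s) x x := by
  rw [two_mul, heat_add, Matrix.mul_apply]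
  refine Finset.sum_congr rfl fun z _ => ?_
  have h := N.heat_symm s x z
  have hz := (N.ν_pos z).ne'
  have : N.heat s z x = N.ν x / N.ν z * N.heat s x z := by
    field_simp
    linarith
  rw [this]
  ring

lemma energy_nonneg (x : ι) {w : ι → ℝ} (h : ∀ z, 0 ≤ w z) (s : ℝ) : 0 ≤ N.energy x w s := by
  have := energy_mono (N := N) x h s
  simpa [energy] using this

lemma tailEnergy_nonneg (x : ι) (ρ : ι → ℝ) (R s : ℝ) : 0 ≤ N.tailEnergy x ρ R s :=
  energy_nonneg x (fun z => by positivity) s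

lemma tailEnergy_le_heat (x : ι) (ρ : ι → ℝ) (R s : ℝ) :
    N.tailEnergy x ρ R s ≤ N.heat (2 * s) x x := by
  rw [← energy_one]
  exact energy_mono x (fun z => by split_ifs <;> norm_num) s

lemma IsAdaptedFun.energy_exp_le {ρ : ι → ℝ} (hρ : N.IsAdaptedFun ρ) {ψ : ι → ℝ} {l : ℝ}
    (hl1 : l ≤ 1) (hψ : ∀ z w, |ψ z - ψ w| ≤ l * |ρ z - ρ w|) (x : ι) {τ s : ℝ}
    (hτs : τ ≤ s) :
    N.energy x (fun z => Real.exp (2 * ψ z)) s ≤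
      Real.exp (2 * l ^ 2 * (s - τ)) * N.energy x (fun z => Real.exp (2 * ψ z)) τ := by
  refine N.energy_exp_le (fun z w h => ?_) (fun z => ?_) x hτs
  · exact (hψ z w).trans (mul_le_one₀ hl1 (abs_nonneg _) (hρ.abs_sub_le z w h))
  · refine le_trans ?_ (mul_le_mul_of_nonneg_left (hρ.sum_le z) (sq_nonneg l))
    rw [Finset.mul_sum]
    refine Finset.sum_le_sum fun w _ => ?_
    rw [← mul_assoc]
    refine mul_le_mul_of_nonneg_right ?_ (N.μ_nonneg z w)
    have h := pow_le_pow_left₀ (abs_nonneg _) (hψ z w) 2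
    rwa [mul_pow, sq_abs, sq_abs] at h

/-- The basic step of the iteration. Davies' estimate is applied with `l` times the truncation of `ρ
- r` to `[0, R - r]`. The weight is `exp (2 * l * (R - r))` beyond radius `R`, at most that beyond
`r`, and `1` inside `r`; the inner region is paid for by the on-diagonal kernel. -/
lemma IsAdaptedFun.tailEnergy_le_add {ρ : ι → ℝ} (hρ : N.IsAdaptedFun ρ) {l : ℝ}
    (hl0 : 0 ≤ l) (hl1 : l ≤ 1) (x : ι) {τ s r R : ℝ} (hτs : τ ≤ s) (hr : r ≤ R) :
    N.tailEnergy x ρ R s ≤ Real.exp (2 * l ^ 2 * (s - τ)) *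
      (N.tailEnergy x ρ r τ + Real.exp (-(2 * l * (R - r))) * N.heat (2 * τ) x x) := by
  set χ : ι → ℝ := fun z => min (max (ρ z - r) 0) (R - r)
  have hχ : ∀ z w, |χ z - χ w| ≤ |ρ z - ρ w| := fun z w => by
    refine (abs_min_sub_min_le_max _ _ _ _).trans ?_
    rw [sub_self, abs_zero]
    refine max_le ((abs_max_sub_max_le_max _ _ _ _).trans ?_) (abs_nonneg _)
    rw [sub_self, abs_zero, sub_sub_sub_cancel_right]
    exact max_le le_rfl (abs_nonneg _)
  have h := hρ.energy_exp_le (ψ := fun z => l * χ z) hl1 (fun z w => by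
    rw [← mul_sub, abs_mul, abs_of_nonneg hl0]
    exact mul_le_mul_of_nonneg_left (hχ z w) hl0) x hτs
  set M := Real.exp (2 * l * (R - r)) with hM
  have hMpos : 0 < M := Real.exp_pos _
  have h1 : M * N.tailEnergy x ρ R s ≤ N.energy x (fun z => Real.exp (2 * (l * χ z))) s := by
    rw [tailEnergy, ← energy_const_mul]
    refine energy_mono x (fun z => ?_) s
    split_ifs with hz
    · have : χ z = R - r := by
        have : R - r ≤ max (ρ z - r) 0 := le_max_of_le_left (by linarith)
        exact min_eq_right this
      rw [this, mul_one, hM, mul_assoc]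
    · rw [mul_zero]; exact (Real.exp_pos _).le
  have h2 : N.energy x (fun z => Real.exp (2 * (l * χ z))) τ ≤
      M * N.tailEnergy x ρ r τ + N.heat (2 * τ) x x := by
    rw [tailEnergy, ← energy_const_mul, ← energy_one, ← energy_add]
    refine energy_mono x (fun z => ?_) τ
    split_ifs with hz
    · have h3 : χ z ≤ R - r := min_le_right _ _
      have h4 : Real.exp (2 * (l * χ z)) ≤ M := by
        rw [hM, Real.exp_le_exp, mul_assoc]
        exact mul_le_mul_of_nonneg_left (mul_le_mul_of_nonneg_left h3 hl0) zero_le_two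
      linarith
    · have : χ z = 0 := by
        have h5 : max (ρ z - r) 0 = 0 := max_eq_right (by linarith)
        simp only [χ, h5]
        exact min_eq_left (by linarith)
      rw [this]; simp
  have h3 : M * N.tailEnergy x ρ R s ≤ Real.exp (2 * l ^ 2 * (s - τ)) *
      (M * N.tailEnergy x ρ r τ + N.heat (2 * τ) x x) :=
    h1.trans (h.trans (mul_le_mul_of_nonneg_left h2 (Real.exp_pos _).le))
  have h4 : Real.exp (-(2 * l * (R - r))) * M = 1 := by
    rw [hM, ← Real.exp_add, neg_add_cancel, Real.exp_zero]
  have h5 := mul_le_mul_of_nonneg_left h3 (Real.exp_pos (-(2 * l * (R - r)))).le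
  rw [← mul_assoc, h4, one_mul] at h5
  refine h5.trans_eq ?_
  rw [mul_left_comm, mul_add, ← mul_assoc _ M, h4, one_mul]

/-- Davies' estimate with the steepest slope `1`, started at time `0`, when the weighted energy of
the unit mass at `x` is `1`. It ends the iteration, at times small compared with the radius. -/
lemma IsAdaptedFun.tailEnergy_le_exp {ρ : ι → ℝ} (hρ : N.IsAdaptedFun ρ) {x : ι} (hx : ρ x = 0)
    {s : ℝ} (hs : 0 ≤ s) (R : ℝ) :
    N.tailEnergy x ρ R s ≤ Real.exp (2 * s - 2 * R) := by
  have h := hρ.energy_exp_le (ψ := ρ) le_rfl (fun z w => by rw [one_mul]) x hs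
  have h0 : N.energy x (fun z => Real.exp (2 * ρ z)) 0 = 1 := by
    rw [energy, Finset.sum_eq_single x]
    · simp [heat_zero, hx, (N.ν_pos x).ne']
    · intro z _ hz
      simp [heat_zero, hz.symm]
    · simp
  rw [h0, mul_one] at h
  have h1 : Real.exp (2 * R) * N.tailEnergy x ρ R s ≤ N.energy x (fun z => Real.exp (2 * ρ z)) s := by
    rw [tailEnergy, ← energy_const_mul]
    refine energy_mono x (fun z => ?_) s
    split_ifs with hz
    · rw [mul_one, Real.exp_le_exp]; linarith
    · rw [mul_zero]; exact (Real.exp_pos _).le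
  rw [Real.exp_sub, le_div_iff₀ (Real.exp_pos _), mul_comm]
  refine (h1.trans h).trans_eq ?_
  norm_num

/-- Grigor'yan's iteration along the times `t / 2 ^ (k + 1)` and the radii
`R * (1 + (3 / 4) ^ k) / 2`. -/
lemma IsAdaptedFun.tailEnergy_le_sum {ρ : ι → ℝ} (hρ : N.IsAdaptedFun ρ) {x : ι} {t R : ℝ}
    (ht : 0 < t) (hR : 0 < R) {K : ℕ} (hK : (2 : ℝ) ^ K ≤ 8 * t / R) {G : ℕ → ℝ}
    (hG : ∀ k, 0 ≤ G k)
    (hEG : ∀ k, N.heat (t / 2 ^ k) x x * G k ≤ 1)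
    (hGK : ∀ k ≤ K, G 0 ≤ Real.exp (k * (R ^ 2 / t) / 4608) * G k) :
    ∀ n ≤ K, N.tailEnergy x ρ R (t / 2) * G 0 ≤
      ∑ k ∈ Finset.range n, Real.exp (-((k + 1) * (R ^ 2 / t) / 4608)) +
        Real.exp (R ^ 2 / t * (9 / 8) ^ n / 324) *
          (N.tailEnergy x ρ (R * (1 + (3 / 4) ^ n) / 2) (t / 2 ^ (n + 1)) * G 0) := by
  set Z := R ^ 2 / t with hZ
  have hZpos : 0 < Z := by positivity
  intro n
  induction n with
  | zero =>
    intro _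
    have h1 : R * (1 + (3 / 4) ^ 0) / 2 = R := by norm_num
    rw [h1, Finset.sum_range_zero, zero_add, zero_add, pow_one]
    refine le_mul_of_one_le_left (mul_nonneg (tailEnergy_nonneg _ _ _ _) (hG 0)) ?_
    exact Real.one_le_exp (by positivity)
  | succ n ih =>
    intro hn
    refine (ih (by omega)).trans ?_
    rw [Finset.sum_range_succ, add_assoc]
    refine add_le_add le_rfl ?_
    set q : ℝ := (9 / 8) ^ n with hq
    have hqpos : 0 < q := by positivity
    -- The slope is proportional to the radius gap `R * (3 / 4) ^ n / 8` over the time gap `t / 2 ^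
    -- (n + 2)`, so that cost and gain are both multiples of `Z * (9 / 8) ^ n`, the gain being `18`
    -- times larger. The bound on `2 ^ K` keeps the slope below `1`.
    set l : ℝ := 1 / 36 * (R / t) * (3 / 2) ^ n with hl
    have hl1 : l ≤ 1 := by
      have h1 : ((3 : ℝ) / 2) ^ n ≤ 8 * t / R :=
        (pow_le_pow_left₀ (by norm_num) (by norm_num) n).trans
          ((pow_le_pow_right₀ (by norm_num) (by omega : n ≤ K)).trans hK)
      have h2 : l ≤ 1 / 36 * (R / t) * (8 * t / R) :=
        mul_le_mul_of_nonneg_left h1 (by positivity)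
      refine h2.trans ?_
      have : 1 / 36 * (R / t) * (8 * t / R) = 8 / 36 := by field_simp
      rw [this]; norm_num
    have hrad : R * (1 + (3 / 4) ^ (n + 1)) / 2 ≤ R * (1 + (3 / 4) ^ n) / 2 := by
      have : ((3 : ℝ) / 4) ^ (n + 1) ≤ (3 / 4) ^ n :=
        pow_le_pow_of_le_one (by norm_num) (by norm_num) (by omega)
      gcongr
    have hstep := hρ.tailEnergy_le_add  (by positivity) hl1 x
      (τ := t / 2 ^ (n + 1 + 1)) (s := t / 2 ^ (n + 1)) (by gcongr <;> norm_num) hrad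
    have hcost : 2 * l ^ 2 * (t / 2 ^ (n + 1) - t / 2 ^ (n + 1 + 1)) = Z * q / 2592 := by
      have h1 : ((3 : ℝ) / 2) ^ n * (3 / 2) ^ n = 2 ^ n * q := by
        rw [hq, ← mul_pow, ← mul_pow]; norm_num
      have h2 : l ^ 2 = (R / t) ^ 2 * (2 ^ n * q) / 1296 := by rw [← h1, hl]; ring
      rw [h2, pow_succ _ (n + 1), pow_succ _ n, hZ]
      field_simp
      norm_num
    have hgain : 2 * l * (R * (1 + (3 / 4) ^ n) / 2 - R * (1 + (3 / 4) ^ (n + 1)) / 2) =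
        Z * q / 144 := by
      have h1 : ((3 : ℝ) / 2) ^ n * (3 / 4) ^ n = q := by
        rw [hq, ← mul_pow]; norm_num
      rw [hl, hZ, ← h1, pow_succ]
      field_simp
      ring
    rw [hcost, hgain] at hstep
    have htau : 2 * (t / 2 ^ (n + 1 + 1)) = t / 2 ^ (n + 1) := by rw [pow_succ _ (n + 1)]; field_simp
    rw [htau] at hstep
    set I' := N.tailEnergy x ρ (R * (1 + (3 / 4) ^ (n + 1)) / 2) (t / 2 ^ (n + 1 + 1))
    set E' := N.heat (t / 2 ^ (n + 1)) x x
    have hE' : 0 ≤ E' := N.heat_nonneg (by positivity) x x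
    -- The prefactor collects the costs of all the steps exactly: `1 / 324 + 1 / 2592 = (9 / 8) /
    -- 324`.
    have hfactor : Real.exp (Z * q / 324) * Real.exp (Z * q / 2592) =
        Real.exp (Z * (9 / 8) ^ (n + 1) / 324) := by
      rw [← Real.exp_add, pow_succ, ← hq]; ring_nf
    have hterm : Real.exp (Z * (9 / 8) ^ (n + 1) / 324) * (Real.exp (-(Z * q / 144)) * E' * G 0) ≤
        Real.exp (-((n + 1) * Z / 4608)) := by
      have h1 : E' * G 0 ≤ Real.exp ((n + 1) * Z / 4608) := by
        have h2 := hGK (n + 1) hn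
        push_cast at h2
        calc E' * G 0 ≤ E' * (Real.exp ((n + 1) * Z / 4608) * G (n + 1)) :=
              mul_le_mul_of_nonneg_left h2 hE'
          _ = Real.exp ((n + 1) * Z / 4608) * (E' * G (n + 1)) := by ring
          _ ≤ Real.exp ((n + 1) * Z / 4608) * 1 :=
              mul_le_mul_of_nonneg_left (hEG (n + 1)) (Real.exp_pos _).le
          _ = _ := mul_one _
      -- After the prefactor the net gain is `Z * q / 288`. It must cover `(n + 1) * Z / 4608`
      -- twice: once for the halvings of time in `G`, once for the decay claimed.
      have hbern : ((n : ℝ) + 1) / 8 ≤ q := by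
        have h3 := one_add_mul_le_pow (a := (1 / 8 : ℝ)) (by norm_num) n
        have h4 : (1 + 1 / 8 : ℝ) = 9 / 8 := by norm_num
        rw [h4, ← hq] at h3
        linarith
      calc _ ≤ Real.exp (Z * (9 / 8) ^ (n + 1) / 324) *
            (Real.exp (-(Z * q / 144)) * Real.exp ((n + 1) * Z / 4608)) := by
            rw [mul_assoc (Real.exp (-(Z * q / 144)))]
            exact mul_le_mul_of_nonneg_left (mul_le_mul_of_nonneg_left h1 (Real.exp_pos _).le)
              (Real.exp_pos _).le
        _ ≤ _ := by
            rw [← Real.exp_add, ← Real.exp_add, Real.exp_le_exp, pow_succ, ← hq]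
            have := mul_le_mul_of_nonneg_left hbern hZpos.le
            linarith
    calc _ ≤ Real.exp (Z * q / 324) * (Real.exp (Z * q / 2592) *
          (I' + Real.exp (-(Z * q / 144)) * E') * G 0) :=
          mul_le_mul_of_nonneg_left (mul_le_mul_of_nonneg_right hstep (hG 0)) (Real.exp_pos _).le
      _ = Real.exp (Z * (9 / 8) ^ (n + 1) / 324) * (Real.exp (-(Z * q / 144)) * E' * G 0) +
          Real.exp (Z * (9 / 8) ^ (n + 1) / 324) * (I' * G 0) := by
          rw [← hfactor]; ring
      _ ≤ _ := add_le_add hterm le_rfl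

lemma sum_exp_neg_le {a : ℝ} (ha : 1 ≤ a) (n : ℕ) :
    ∑ k ∈ Finset.range n, Real.exp (-((k + 1) * a)) ≤ 2 * Real.exp (-a) := by
  have hhalf : Real.exp (-a) ≤ 1 / 2 := by
    rw [Real.exp_neg, inv_eq_one_div]
    refine one_div_le_one_div_of_le (by norm_num) ?_
    linarith [Real.add_one_le_exp a]
  have h : ∀ k : ℕ, Real.exp (-((k + 1) * a)) = Real.exp (-a) * Real.exp (-a) ^ k := fun k => by
    rw [← Real.exp_nat_mul, ← Real.exp_add]; ring_nf
  have h2 : ∀ n : ℕ, ∑ k ∈ Finset.range n, ((1 : ℝ) / 2) ^ k ≤ 2 := sum_geometric_two_le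
  rw [Finset.sum_congr rfl fun k _ => h k, ← Finset.mul_sum, mul_comm]
  refine mul_le_mul_of_nonneg_right ?_ (Real.exp_pos _).le
  refine (Finset.sum_le_sum fun k _ => ?_).trans (h2 n)
  exact pow_le_pow_left₀ (Real.exp_pos _).le hhalf k

/-- The Gaussian decay comes either from a large ratio `f t / f (α * t)` or, if that ratio is small,
from the iteration, since regularity then bounds all earlier doubling ratios. The constant `9`
leaves room in every case and is a square. -/
lemma IsAdaptedFun.tailEnergy_mul_le {ρ : ι → ℝ} (hρ : N.IsAdaptedFun ρ) {x : ι} (hx : ρ x = 0)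
    {f : ℝ → ℝ} (hf0 : ∀ s, 0 ≤ s → 0 ≤ f s) (hmono : MonotoneOn f (Ici 0))
    (hdiag : ∀ s, 0 ≤ s → N.heat s x x * f s ≤ 1) {A B α δ t R T₁ : ℝ}
    (hA : 1 ≤ A) (hAB : A ≤ B) (hα : 0 < α) (hα1 : α ≤ 1) (hαδ : α * δ ≤ 1 / 64)
    (ht : 8 * α⁻¹ ^ 2 * T₁ ^ 2 ≤ t) (hR : 0 ≤ R) (hRt : 2 * R ≤ t)
    (hreg : ∀ s, T₁ ≤ s → s < α * t → f (2 * s) * f (α * t) ≤ B * f t * f s)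
    (hexp : ∀ s, T₁ ≤ s → s ≤ α * t → f s ≤ A * Real.exp (δ * s)) :
    N.tailEnergy x ρ R (t / 2) * f (α * t) ≤ 9 * B * Real.exp (-(R ^ 2 / t / 4608)) := by
  have ht0 : 0 ≤ t := by linarith
  have hαt : α * t ≤ t := mul_le_of_le_one_left ht0 hα1
  have hαt0 : 0 ≤ α * t := mul_nonneg hα.le ht0
  set Z := R ^ 2 / t with hZ
  have hI0 := tailEnergy_nonneg (N := N) x ρ R (t / 2)
  have hItop : N.tailEnergy x ρ R (t / 2) * f t ≤ 1 := by
    refine le_trans (mul_le_mul_of_nonneg_right (tailEnergy_le_heat x ρ R (t / 2)) (hf0 t ht0)) ?_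
    rw [mul_div_cancel₀ t two_ne_zero]
    exact hdiag t ht0
  have hg0 : 0 ≤ f (α * t) := hf0 _ hαt0
  have hB : 1 ≤ B := hA.trans hAB
  rcases lt_or_ge Z 4608 with hZlt | hZge
  · have h1 : N.tailEnergy x ρ R (t / 2) * f (α * t) ≤ 1 :=
      (mul_le_mul_of_nonneg_left (hmono hαt0 ht0 hαt) hI0).trans hItop
    have h2 : Real.exp (-1) ≤ Real.exp (-(Z / 4608)) := Real.exp_le_exp.2 (by linarith)
    have h3 := Real.exp_neg_one_gt_d9
    have h4 : 1 * Real.exp (-(Z / 4608)) ≤ B * Real.exp (-(Z / 4608)) :=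
      mul_le_mul_of_nonneg_right hB (Real.exp_pos _).le
    linarith
  have hRpos : 0 < R := by
    rcases hR.eq_or_lt with h | h
    · rw [hZ, ← h] at hZge; norm_num at hZge
    · exact h
  have htpos : 0 < t := by linarith
  rcases lt_or_ge (Real.exp (Z / 4608) * f (α * t)) (B * f t) with hQ | hQ
  · have h1 : Real.exp (Z / 4608) * (N.tailEnergy x ρ R (t / 2) * f (α * t)) ≤ B := by
      calc _ = N.tailEnergy x ρ R (t / 2) * (Real.exp (Z / 4608) * f (α * t)) := by ring
        _ ≤ N.tailEnergy x ρ R (t / 2) * (B * f t) := mul_le_mul_of_nonneg_left hQ.le hI0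
        _ = B * (N.tailEnergy x ρ R (t / 2) * f t) := by ring
        _ ≤ B * 1 := mul_le_mul_of_nonneg_left hItop (by linarith)
        _ = B := mul_one B
    have h2 : N.tailEnergy x ρ R (t / 2) * f (α * t) ≤ B * Real.exp (-(Z / 4608)) := by
      rw [Real.exp_neg, ← div_eq_mul_inv, le_div_iff₀ (Real.exp_pos _), mul_comm]
      exact h1
    have h3 : 0 ≤ B * Real.exp (-(Z / 4608)) := by positivity
    linarith
  rcases hg0.eq_or_lt with hg | hg
  · rw [← hg, mul_zero]; positivity
  -- The number of halvings is chosen so that `t / 2 ^ K` lies between `R / 8` and `R / 4`.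
  obtain ⟨k₀, hk1, hk2⟩ := exists_nat_pow_near (x := 4 * t / R) (y := 2)
    (by rw [le_div_iff₀ hRpos]; linarith) one_lt_two
  set K := k₀ + 1
  have hKup : (2 : ℝ) ^ K ≤ 8 * t / R := by
    rw [pow_succ]
    have : 8 * t / R = 4 * t / R * 2 := by ring
    rw [this]
    exact mul_le_mul_of_nonneg_right hk1 zero_le_two
  have h2K : (0 : ℝ) < 2 ^ K := by positivity
  have hRK : R * 2 ^ K ≤ 8 * t := by rw [le_div_iff₀ hRpos] at hKup; linarith
  have htK : t / 2 ^ K ≤ R / 4 := by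
    rw [div_lt_iff₀ hRpos] at hk2
    rw [div_le_iff₀ h2K]; linarith
  -- This is the purpose of the lower bound on `t`: in the present case `R ^ 2 ≥ 8 * t`, so even the
  -- smallest time reached is in the range where `f` is regular.
  have hT₁K : T₁ ≤ α * (t / 2 ^ K) := by
    have h1 : R / 8 ≤ t / 2 ^ K := by rw [le_div_iff₀ h2K]; linarith
    have h2 : 8 * t ≤ R ^ 2 := by
      rw [hZ, le_div_iff₀ htpos] at hZge; linarith
    have h3 : 8 * T₁ ^ 2 ≤ t * α ^ 2 := by
      have h4 := mul_le_mul_of_nonneg_right ht (sq_nonneg α)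
      have h5 : 8 * α⁻¹ ^ 2 * T₁ ^ 2 * α ^ 2 = 8 * T₁ ^ 2 := by field_simp
      linarith
    have h6 : T₁ ≤ α * (R / 8) := by
      refine abs_le_of_sq_le_sq' ?_ (by positivity) |>.2
      have h7 := mul_le_mul_of_nonneg_left h2 (sq_nonneg α)
      rw [mul_pow, div_pow]
      linarith
    exact h6.trans (mul_le_mul_of_nonneg_left h1 hα.le)
  set G : ℕ → ℝ := fun k => f (α * (t / 2 ^ k)) with hGdef
  have hG0 : G 0 = f (α * t) := by simp [hGdef]
  have hGnn : ∀ k, 0 ≤ G k := fun k => hf0 _ (by positivity)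
  have hEG : ∀ k, N.heat (t / 2 ^ k) x x * G k ≤ 1 := fun k => by
    have h0 : 0 ≤ t / 2 ^ k := by positivity
    have h1 : α * (t / 2 ^ k) ≤ t / 2 ^ k := mul_le_of_le_one_left h0 hα1
    exact (mul_le_mul_of_nonneg_left (hmono (mem_Ici.2 (mul_nonneg hα.le h0)) h0 h1)
      (N.heat_nonneg h0 x x)).trans (hdiag _ h0)
  have hGK : ∀ k ≤ K, G 0 ≤ Real.exp (k * Z / 4608) * G k := by
    intro k
    induction k with
    | zero => intro _; simp
    | succ k ih =>
      intro hk
      refine (ih (by omega)).trans ?_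
      have hs1 : T₁ ≤ α * (t / 2 ^ (k + 1)) :=
        hT₁K.trans (mul_le_mul_of_nonneg_left
          (div_le_div_of_nonneg_left ht0 (by positivity) (pow_le_pow_right₀ one_le_two hk)) hα.le)
      have hs2 : α * (t / 2 ^ (k + 1)) < α * t := by
        refine mul_lt_mul_of_pos_left (div_lt_self htpos ?_) hα
        exact one_lt_pow₀ one_lt_two (by omega)
      have h := hreg _ hs1 hs2
      have h2 : 2 * (α * (t / 2 ^ (k + 1))) = α * (t / 2 ^ k) := by rw [pow_succ]; field_simp
      rw [h2] at h
      have h3 : G k * f (α * t) ≤ Real.exp (Z / 4608) * G (k + 1) * f (α * t) := by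
        refine h.trans ?_
        have h4 := mul_le_mul_of_nonneg_right hQ (hGnn (k + 1))
        exact h4.trans_eq (by ring)
      have h5 := le_of_mul_le_mul_right h3 hg
      have h6 := mul_le_mul_of_nonneg_left h5 (Real.exp_pos (k * Z / 4608)).le
      refine h6.trans_eq ?_
      rw [← mul_assoc, ← Real.exp_add]
      push_cast
      ring_nf
  have hmain := hρ.tailEnergy_le_sum (x := x) htpos hRpos hKup hGnn hEG hGK K le_rfl
  rw [hG0] at hmain
  have hsum : ∑ k ∈ Finset.range K, Real.exp (-((k + 1) * Z / 4608)) ≤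
      2 * Real.exp (-(Z / 4608)) := by
    have := sum_exp_neg_le (a := Z / 4608) (by linarith) K
    simpa only [mul_div_assoc] using this
  have hZK : Z * 2 ^ K ≤ 8 * R := by
    rw [hZ, div_mul_eq_mul_div, div_le_iff₀ htpos]
    have := mul_le_mul_of_nonneg_left hRK hR
    linarith
  -- At the last step the radius is at least `R / 2` and the time at most `R / 8`, so the tail is at
  -- most `exp (R / 4 - R)`. Every other factor is `A` times the exponential of a small multiple of
  -- `R`, because `Z * 2 ^ K ≤ 8 * R`; and `Z ≤ R`.
  have hlast : Real.exp (Z * (9 / 8) ^ K / 324) *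
      (N.tailEnergy x ρ (R * (1 + (3 / 4) ^ K) / 2) (t / 2 ^ (K + 1)) * f (α * t)) ≤
      A * Real.exp (-(Z / 4608)) := by
    have h1 : N.tailEnergy x ρ (R * (1 + (3 / 4) ^ K) / 2) (t / 2 ^ (K + 1)) ≤
        Real.exp (R / 4 - R) := by
      refine (hρ.tailEnergy_le_exp hx (by positivity) _).trans (Real.exp_le_exp.2 ?_)
      have h2 : 2 * (t / 2 ^ (K + 1)) = t / 2 ^ K := by rw [pow_succ]; field_simp
      have h3 : 0 ≤ R * (3 / 4) ^ K := by positivity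
      linarith
    have h4 : f (α * t) ≤ Real.exp (8 * R / 4608) * (A * Real.exp (R / 256)) := by
      have h5 := hGK K le_rfl
      rw [hG0] at h5
      refine h5.trans ?_
      have hKle : (K : ℝ) ≤ 2 ^ K := by exact_mod_cast (Nat.lt_two_pow_self (n := K)).le
      have hZ0 : 0 ≤ Z := by linarith
      have h6 : Real.exp (K * Z / 4608) ≤ Real.exp (8 * R / 4608) := by
        rw [Real.exp_le_exp]
        have := mul_le_mul_of_nonneg_right hKle hZ0
        linarith
      have h7 : G K ≤ A * Real.exp (R / 256) := by
        refine (hexp _ hT₁K (mul_le_mul_of_nonneg_left (div_le_self ht0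
          (one_le_pow₀ one_le_two)) hα.le)).trans ?_
        refine mul_le_mul_of_nonneg_left (Real.exp_le_exp.2 ?_) (by linarith)
        have h8 : 0 ≤ t / 2 ^ K := by positivity
        have h9 := mul_le_mul_of_nonneg_right hαδ h8
        calc δ * (α * (t / 2 ^ K)) = α * δ * (t / 2 ^ K) := by ring
          _ ≤ 1 / 64 * (t / 2 ^ K) := h9
          _ ≤ R / 256 := by linarith
      exact mul_le_mul h6 h7 (hGnn K) (Real.exp_pos _).le
    have h10 : Real.exp (Z * (9 / 8) ^ K / 324) ≤ Real.exp (8 * R / 324) := by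
      rw [Real.exp_le_exp]
      have h11 : ((9 : ℝ) / 8) ^ K ≤ 2 ^ K := pow_le_pow_left₀ (by norm_num) (by norm_num) K
      have h12 := mul_le_mul_of_nonneg_left h11 (by linarith : 0 ≤ Z)
      linarith
    have hZR : Z ≤ R := by
      rw [hZ, div_le_iff₀ htpos, sq]
      exact mul_le_mul_of_nonneg_left (by linarith) hR
    calc _ ≤ Real.exp (8 * R / 324) *
          (Real.exp (R / 4 - R) * (Real.exp (8 * R / 4608) * (A * Real.exp (R / 256)))) := by
          refine mul_le_mul h10 (mul_le_mul h1 h4 hg0 (Real.exp_pos _).le)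
            (mul_nonneg (tailEnergy_nonneg _ _ _ _) hg0) (Real.exp_pos _).le
      _ = A * Real.exp (8 * R / 324 + (R / 4 - R + (8 * R / 4608 + R / 256))) := by
          simp only [Real.exp_add]; ring
      _ ≤ _ := by
          refine mul_le_mul_of_nonneg_left (Real.exp_le_exp.2 ?_) (by linarith)
          linarith
  have he : 0 < Real.exp (-(Z / 4608)) := Real.exp_pos _
  have h1 := mul_le_mul_of_nonneg_right hB he.le
  have h2 := mul_le_mul_of_nonneg_right hAB he.le
  linarith

end KilledNetwork

/-! ### Doubling ratios of regular functions. -/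

lemma IsRegularOn.pow_ratio_le {A γ : ℝ} {f : ℝ → ℝ} {a : ℝ} {b : EReal}
    (h : IsRegularOn A γ f a b) (hf : ∀ s, 0 ≤ s → 0 ≤ f s) (hA : 1 ≤ A) (hγ : 1 < γ)
    (ha : 0 ≤ a) {s t : ℝ} (hs : a ≤ s) (hst : s < t) (n : ℕ)
    (hn : ((γ ^ n * t : ℝ) : EReal) < b) :
    f (γ ^ n * s) * f t ≤ A ^ n * f (γ ^ n * t) * f s := by
  have hs0 : 0 ≤ s := ha.trans hs
  have ht0 : 0 ≤ t := hs0.trans hst.le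
  have hγ0 : 0 ≤ γ := by linarith
  have hA0 : 0 ≤ A := by linarith
  induction n with
  | zero => simp [mul_comm]
  | succ n ih =>
    have hpow : (1 : ℝ) ≤ γ ^ n := one_le_pow₀ hγ.le
    have hle : γ ^ n * t ≤ γ ^ (n + 1) * t := by
      rw [pow_succ]
      exact mul_le_mul_of_nonneg_right (le_mul_of_one_le_right (by positivity) hγ.le) ht0
    have ih' := ih ((EReal.coe_le_coe_iff.2 hle).trans_lt hn)
    have h1 := h.ratio_le (γ ^ n * s) (γ ^ n * t)
      (hs.trans (le_mul_of_one_le_left hs0 hpow))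
      (mul_lt_mul_of_pos_left hst (by positivity)) (by rwa [← mul_assoc, ← pow_succ'])
    rw [← mul_assoc, ← mul_assoc, ← pow_succ'] at h1
    have hft : f t ≤ f (γ ^ n * t) := h.monotoneOn ht0 (mem_Ici.2 (by positivity))
      (le_mul_of_one_le_left ht0 hpow)
    -- The ratios telescope after cancelling `f (γ ^ n * t)`; if `f t = 0`, nothing can be cancelled
    -- but the left side vanishes.
    rcases (hf t ht0).eq_or_lt with h0 | hpos
    · rw [← h0, mul_zero]
      exact mul_nonneg (mul_nonneg (by positivity) (hf _ (by positivity))) (hf s hs0)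
    refine le_of_mul_le_mul_right ?_ (hpos.trans_le hft)
    calc f (γ ^ (n + 1) * s) * f t * f (γ ^ n * t)
        = f (γ ^ (n + 1) * s) * f (γ ^ n * t) * f t := by ring
      _ ≤ A * f (γ ^ (n + 1) * t) * f (γ ^ n * s) * f t := mul_le_mul_of_nonneg_right h1 hpos.le
      _ = A * f (γ ^ (n + 1) * t) * (f (γ ^ n * s) * f t) := by ring
      _ ≤ A * f (γ ^ (n + 1) * t) * (A ^ n * f (γ ^ n * t) * f s) :=
          mul_le_mul_of_nonneg_left ih' (mul_nonneg hA0 (hf _ (by positivity)))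
      _ = A ^ (n + 1) * f (γ ^ (n + 1) * t) * f s * f (γ ^ n * t) := by ring

lemma two_le_pow_betaConst {γ : ℝ} (hγ : 1 < γ) : 2 ≤ γ ^ betaConst γ := by
  have hlog := Real.log_pos hγ
  have h : Real.log 2 ≤ betaConst γ * Real.log γ := by
    rw [← div_le_iff₀ hlog]
    exact Nat.le_ceil _
  rw [← Real.log_pow] at h
  exact (Real.log_le_log_iff two_pos (by positivity)).1 h

lemma pow_betaConst_le {γ : ℝ} (hγ : 1 < γ) : γ ^ betaConst γ ≤ 2 * γ := by
  have hlog := Real.log_pos hγ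
  have h : (betaConst γ : ℝ) * Real.log γ ≤ Real.log 2 + Real.log γ := by
    have h1 := (Nat.ceil_lt_add_one (div_nonneg (Real.log_nonneg one_le_two) hlog.le)).le
    have h2 := mul_le_mul_of_nonneg_right h1 hlog.le
    rwa [add_mul, div_mul_cancel₀ _ hlog.ne', one_mul] at h2
  rw [← Real.log_pow, ← Real.log_mul two_ne_zero (by positivity)] at h
  exact (Real.log_le_log_iff (by positivity) (by positivity)).1 h

lemma one_le_betaConst {γ : ℝ} (hγ : 1 < γ) : 1 ≤ betaConst γ :=
  Nat.ceil_pos.2 (div_pos (Real.log_pos one_lt_two) (Real.log_pos hγ))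

lemma alphaConst_pos {γ δ : ℝ} (hγ : 1 < γ) (hδ : 1 ≤ δ) : 0 < alphaConst γ δ :=
  lt_min (by positivity) (by positivity)

lemma alphaConst_le_one {γ δ : ℝ} (hδ : 1 ≤ δ) : alphaConst γ δ ≤ 1 :=
  (min_le_right _ _).trans (inv_le_one_of_one_le₀ (by linarith))

lemma alphaConst_mul_le {γ δ : ℝ} (hδ : 1 ≤ δ) : alphaConst γ δ * δ ≤ 1 / 64 := by
  refine (mul_le_mul_of_nonneg_right (min_le_right _ _) (by linarith)).trans_eq ?_
  field_simp

/-- Since `2 ≤ γ ^ β ≤ 2 * γ`, doubling is dominated by `β` steps of ratio `γ`, and `α ≤ (2 * γ)⁻¹`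
ensures that `β` steps from `α * t` do not go beyond `t`. -/
lemma IsRegularOn.two_mul_le {A γ δ : ℝ} {f : ℝ → ℝ} {a : ℝ} {b : EReal}
    (h : IsRegularOn A γ f a b) (hf : ∀ s, 0 ≤ s → 0 ≤ f s) (hA : 1 ≤ A) (hγ : 1 < γ)
    (hδ : 1 ≤ δ) (ha : 0 ≤ a) {s t : ℝ} (hs : a ≤ s) (ht : (t : EReal) < b)
    (hst : s < alphaConst γ δ * t) :
    f (2 * s) * f (alphaConst γ δ * t) ≤ A ^ betaConst γ * f t * f s := by
  set α := alphaConst γ δ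
  have hα : 0 < α := alphaConst_pos hγ hδ
  have hs0 : 0 ≤ s := ha.trans hs
  have hαt : 0 ≤ α * t := hs0.trans hst.le
  have ht0 : 0 ≤ t := nonneg_of_mul_nonneg_right hαt hα
  have hle : γ ^ betaConst γ * (α * t) ≤ t := by
    have h1 : γ ^ betaConst γ * α ≤ 1 := by
      refine (mul_le_mul (pow_betaConst_le hγ) (min_le_left _ _) hα.le (by linarith)).trans_eq ?_
      exact mul_inv_cancel₀ (by linarith)
    rw [← mul_assoc]
    exact mul_le_of_le_one_left ht0 h1
  have h1 := h.pow_ratio_le hf hA hγ ha hs hst (betaConst γ)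
    ((EReal.coe_le_coe_iff.2 hle).trans_lt ht)
  have h2 : f (2 * s) ≤ f (γ ^ betaConst γ * s) :=
    h.monotoneOn (mem_Ici.2 (by positivity)) (mem_Ici.2 (by positivity))
      (mul_le_mul_of_nonneg_right (two_le_pow_betaConst hγ) hs0)
  have h3 : f (γ ^ betaConst γ * (α * t)) ≤ f t :=
    h.monotoneOn (mem_Ici.2 (by positivity)) ht0 hle
  calc f (2 * s) * f (α * t) ≤ f (γ ^ betaConst γ * s) * f (α * t) :=
        mul_le_mul_of_nonneg_right h2 (hf _ hαt)
    _ ≤ _ := h1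
    _ ≤ _ := mul_le_mul_of_nonneg_right (mul_le_mul_of_nonneg_left h3 (by positivity)) (hf s hs0)

/-! ### From tail energies to the off-diagonal bound. -/

namespace KilledNetwork

variable {ι : Type*} [Fintype ι] [DecidableEq ι] {N : KilledNetwork ι}

lemma sum_mul_heat_le (x y : ι) (ρ : ι → ℝ) (R s : ℝ) :
    ∑ z, (if R ≤ ρ z then 1 else 0) * (N.heat s x z * √(N.ν x / N.ν z)) *
      (N.heat s y z * √(N.ν y / N.ν z)) ≤
      √(N.tailEnergy x ρ R s) * √(N.heat (2 * s) y y) := by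
  refine (Real.sum_mul_le_sqrt_mul_sqrt _ _ _).trans_eq ?_
  have h : ∀ a b, √(N.ν a / N.ν b) ^ 2 = N.ν a / N.ν b := fun a b =>
    Real.sq_sqrt (div_nonneg (N.ν_pos a).le (N.ν_pos b).le)
  congr 2
  · refine Finset.sum_congr rfl fun z _ => ?_
    rw [mul_pow, mul_pow, h]
    dsimp only
    by_cases hz : R ≤ ρ z
    · simp only [hz, if_true]; ring
    · simp only [hz, if_false]; ring
  · rw [← energy_one]
    refine Finset.sum_congr rfl fun z _ => ?_
    rw [mul_pow, h, mul_one]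

/-- In the semigroup identity at the midpoint every `z` lies in at least one of the two tails.
Cauchy-Schwarz puts the tail on one factor and leaves the full energy, an on-diagonal kernel, on the
other. -/
lemma heat_le_sqrt_tailEnergy {s : ℝ} (hs : 0 ≤ s) (x y : ι) (ρ ρ' : ι → ℝ) {R : ℝ}
    (hR : ∀ z, 2 * R ≤ ρ z + ρ' z) :
    N.heat (2 * s) x y ≤ √(N.ν y / N.ν x) *
      (√(N.tailEnergy x ρ R s) * √(N.heat (2 * s) y y) +
        √(N.tailEnergy y ρ' R s) * √(N.heat (2 * s) x x)) := by
  refine le_trans ?_ (mul_le_mul_of_nonneg_left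
    (add_le_add (sum_mul_heat_le x y ρ R s) (sum_mul_heat_le y x ρ' R s)) (Real.sqrt_nonneg _))
  rw [← Finset.sum_add_distrib, Finset.mul_sum, two_mul, heat_add, Matrix.mul_apply]
  refine Finset.sum_le_sum fun z _ => ?_
  have hx := N.ν_pos x
  have hy := N.ν_pos y
  have hz := N.ν_pos z
  have hzy : N.heat s z y = N.ν y / N.ν z * N.heat s y z := by
    have h := N.heat_symm s y z
    field_simp
    linarith
  have hsqrt : √(N.ν y / N.ν x) * (√(N.ν x / N.ν z) * √(N.ν y / N.ν z)) = N.ν y / N.ν z := by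
    rw [← mul_assoc, ← Real.sqrt_mul (by positivity),
      show N.ν y / N.ν x * (N.ν x / N.ν z) = N.ν y / N.ν z by field_simp,
      Real.mul_self_sqrt (by positivity)]
  have hprod : N.heat s x z * N.heat s z y = √(N.ν y / N.ν x) *
      (N.heat s x z * √(N.ν x / N.ν z) * (N.heat s y z * √(N.ν y / N.ν z))) := by
    rw [hzy]
    linear_combination -(N.heat s x z * N.heat s y z) * hsqrt
  rw [hprod]
  refine mul_le_mul_of_nonneg_left ?_ (Real.sqrt_nonneg _)
  set a := N.heat s x z * √(N.ν x / N.ν z)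
  set b := N.heat s y z * √(N.ν y / N.ν z)
  have hab : 0 ≤ a * b := mul_nonneg (mul_nonneg (N.heat_nonneg hs x z) (Real.sqrt_nonneg _))
    (mul_nonneg (N.heat_nonneg hs y z) (Real.sqrt_nonneg _))
  rcases le_or_gt R (ρ z) with h | h
  · rw [if_pos h]
    split_ifs <;> nlinarith
  · have h' : R ≤ ρ' z := by linarith [hR z]
    rw [if_neg h.not_ge, if_pos h']
    nlinarith

/-- The off-diagonal Gaussian bound for a killed finite network. -/
theorem heat_mul_sqrt_le {x : Fin 2 → ι} {ρ : Fin 2 → ι → ℝ} (hρ : ∀ i, N.IsAdaptedFun (ρ i))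
    (hx : ∀ i, ρ i (x i) = 0) {D : ℝ} (hD : 0 ≤ D) (hDρ : ∀ z, D ≤ ρ 0 z + ρ 1 z)
    {f : Fin 2 → ℝ → ℝ} (hf : ∀ i s, 0 ≤ s → 0 ≤ f i s)
    (hdiag : ∀ i s, 0 ≤ s → N.heat s (x i) (x i) * f i s ≤ 1)
    {A γ δ T₁ : ℝ} {T₂ : EReal} (hA : 1 ≤ A) (hγ : 1 < γ) (hδ : 1 ≤ δ) (hT₁ : 0 ≤ T₁)
    (hreg : ∀ i, IsRegularOn A γ (f i) T₁ T₂)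
    (hexp : ∀ i (s : ℝ), T₁ ≤ s → (s : EReal) < T₂ → f i s ≤ A * Real.exp (δ * s))
    {t : ℝ} (ht : 8 * (alphaConst γ δ)⁻¹ ^ 2 * T₁ ^ 2 ≤ t) (hDt : D ≤ t) (htT : (t : EReal) < T₂) :
    N.heat t (x 0) (x 1) * √(f 0 (alphaConst γ δ * t) * f 1 (alphaConst γ δ * t)) ≤
      6 * A ^ betaConst γ * √(N.ν (x 1) / N.ν (x 0)) * Real.exp (-(1 / 36864) * (D ^ 2 / t)) := by
  set α := alphaConst γ δ
  set B := A ^ betaConst γ with hBdef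
  have hα : 0 < α := alphaConst_pos hγ hδ
  have hα1 : α ≤ 1 := alphaConst_le_one hδ
  have hAB : A ≤ B := le_self_pow₀ hA (Nat.one_le_iff_ne_zero.1 (one_le_betaConst hγ))
  have hB : 1 ≤ B := hA.trans hAB
  have ht0 : 0 ≤ t := hD.trans hDt
  have hαt : α * t ≤ t := mul_le_of_le_one_left ht0 hα1
  have hαt0 : 0 ≤ α * t := mul_nonneg hα.le ht0
  set g : Fin 2 → ℝ := fun i => f i (α * t)
  have hg : ∀ i, 0 ≤ g i := fun i => hf i _ hαt0
  set e := Real.exp (-(D ^ 2 / t / 18432)) with he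
  -- The radius `D / 2` turns `4608` into `18432`, and the square root doubles it to `36864`. The
  -- square root of `B` is weakened to `B`.
  have htail : ∀ i, √(N.tailEnergy (x i) (ρ i) (D / 2) (t / 2)) * √(g i) ≤ 3 * B * √e := by
    intro i
    have h := (hρ i).tailEnergy_mul_le (hx i) (hf i) (hreg i).monotoneOn (hdiag i) hA hAB hα hα1
      (alphaConst_mul_le hδ) ht (R := D / 2) (by linarith) (by linarith)
      (fun s hs hst => (hreg i).two_mul_le (hf i) hA hγ hδ hT₁ hs htT hst)
      (fun s hs hst => hexp i s hs ((EReal.coe_le_coe_iff.2 (hst.trans hαt)).trans_lt htT))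
    have h2 : (D / 2) ^ 2 / t / 4608 = D ^ 2 / t / 18432 := by ring
    rw [h2] at h
    rw [← Real.sqrt_mul (tailEnergy_nonneg _ _ _ _)]
    refine Real.sqrt_le_iff.2 ⟨by positivity, h.trans ?_⟩
    rw [mul_pow, Real.sq_sqrt (Real.exp_pos _).le]
    refine mul_le_mul_of_nonneg_right ?_ (Real.exp_pos _).le
    have h3 : B * 1 ≤ B * B := mul_le_mul_of_nonneg_left hB (by linarith)
    linarith
  have hheat : ∀ i, √(N.heat t (x i) (x i)) * √(g i) ≤ 1 := by
    intro i
    rw [← Real.sqrt_mul (N.heat_nonneg ht0 _ _), Real.sqrt_le_one]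
    exact (mul_le_mul_of_nonneg_left ((hreg i).monotoneOn hαt0 ht0 hαt)
      (N.heat_nonneg ht0 _ _)).trans (hdiag i t ht0)
  have hmain := heat_le_sqrt_tailEnergy (N := N) (s := t / 2) (by linarith) (x 0) (x 1) (ρ 0) (ρ 1)
    (R := D / 2) (fun z => by linarith [hDρ z])
  rw [mul_div_cancel₀ t two_ne_zero] at hmain
  have hsqe : √e = Real.exp (-(1 / 36864) * (D ^ 2 / t)) := by
    rw [he, Real.sqrt_eq_iff_mul_self_eq (Real.exp_pos _).le (Real.exp_pos _).le, ← Real.exp_add]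
    ring_nf
  have hsq := Real.sqrt_nonneg (N.ν (x 1) / N.ν (x 0))
  have h3 : 0 ≤ 3 * B * √e := by positivity
  calc N.heat t (x 0) (x 1) * √(g 0 * g 1)
      ≤ √(N.ν (x 1) / N.ν (x 0)) *
        (√(N.tailEnergy (x 0) (ρ 0) (D / 2) (t / 2)) * √(N.heat t (x 1) (x 1)) +
        √(N.tailEnergy (x 1) (ρ 1) (D / 2) (t / 2)) * √(N.heat t (x 0) (x 0))) *
        (√(g 0) * √(g 1)) := by
        rw [Real.sqrt_mul (hg 0)]
        exact mul_le_mul_of_nonneg_right hmain (by positivity)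
    _ = √(N.ν (x 1) / N.ν (x 0)) *
        ((√(N.tailEnergy (x 0) (ρ 0) (D / 2) (t / 2)) * √(g 0)) *
            (√(N.heat t (x 1) (x 1)) * √(g 1)) +
          (√(N.tailEnergy (x 1) (ρ 1) (D / 2) (t / 2)) * √(g 1)) *
            (√(N.heat t (x 0) (x 0)) * √(g 0))) := by ring
    _ ≤ √(N.ν (x 1) / N.ν (x 0)) * (3 * B * √e * 1 + 3 * B * √e * 1) := by
        refine mul_le_mul_of_nonneg_left (add_le_add ?_ ?_) hsq
        · exact mul_le_mul (htail 0) (hheat 1) (by positivity) h3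
        · exact mul_le_mul (htail 1) (hheat 0) (by positivity) h3
    _ = _ := by rw [← hsqe]; ring

end KilledNetwork

/-! ### One step of the jump chain and of its exponential clocks. -/

instance isProbabilityMeasure_expMeasure_one : IsProbabilityMeasure (expMeasure 1) :=
  isProbabilityMeasure_expMeasure one_pos

lemma lintegral_expMeasure_one {g : ℝ → ℝ≥0∞} (hg : Measurable g) :
    ∫⁻ e, g e ∂expMeasure 1 = ∫⁻ e in Ioi 0, ENNReal.ofReal (Real.exp (-e)) * g e := by
  have h : expMeasure 1 = volume.withDensity (exponentialPDF 1) := rfl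
  rw [h, lintegral_withDensity_eq_lintegral_mul _
    (f := exponentialPDF 1)
    (measurable_exponentialPDFReal 1).ennreal_ofReal hg, ← lintegral_indicator measurableSet_Ioi]
  refine lintegral_congr_ae ?_
  filter_upwards [Measure.ae_ne volume (0 : ℝ)] with e he
  rw [Pi.mul_apply, indicator_apply]
  split_ifs with h0
  · rw [exponentialPDF_of_nonneg (mem_Ioi.1 h0).le, one_mul, one_mul]
  · rw [exponentialPDF_of_neg (lt_of_le_of_ne (not_lt.1 h0) he), zero_mul]

/-- In a sequence of independent variables with law `P`, the `n`-th one is independent of those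
before. -/
lemma lintegral_infinitePi_apply {P : Measure ℝ} [IsProbabilityMeasure P] (n : ℕ)
    {φ : (ℕ → ℝ) → ℝ → ℝ≥0∞} (hφ : Measurable (Function.uncurry φ))
    (hdep : ∀ E E' e, (∀ k < n, E k = E' k) → φ E e = φ E' e) :
    ∫⁻ E, φ E (E n) ∂Measure.infinitePi (fun _ : ℕ => P) =
      ∫⁻ E, ∫⁻ e, φ E e ∂P ∂Measure.infinitePi (fun _ : ℕ => P) := by
  set Q := Measure.infinitePi (fun _ : ℕ => P)
  let r : (ℕ → ℝ) → (Finset.range n → ℝ) := fun E k => E k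
  -- The coordinates from `n` on are filled arbitrarily, as `φ` does not see them; it therefore
  -- factors through the restriction `r`.
  let j : (Finset.range n → ℝ) → (ℕ → ℝ) := fun u k =>
    if h : k ∈ Finset.range n then u ⟨k, h⟩ else 0
  have hr : Measurable r := measurable_pi_lambda _ fun k => measurable_pi_apply _
  have hj : Measurable j := measurable_pi_lambda _ fun k => by
    by_cases h : k ∈ Finset.range n
    · simp only [j, h, dif_pos]; exact measurable_pi_apply _
    · simp only [j, h]; exact measurable_const
  have hrj : ∀ E e, φ E e = φ (j (r E)) e := fun E e => hdep _ _ _ fun k hk => by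
    simp [j, r, hk]
  have hind : IndepFun r (fun E : ℕ → ℝ => E n) Q := by
    have h := (iIndepFun_infinitePi (P := fun _ : ℕ => P) (X := fun _ e => e)
      (fun _ => measurable_id)).indepFun_finset (Finset.range n) {n} (by simp)
      (fun i => measurable_pi_apply i)
    have hp : Measurable fun u : ({n} : Finset ℕ) → ℝ => u ⟨n, by simp⟩ := measurable_pi_apply _
    exact h.comp measurable_id hp
  have hmap := (indepFun_iff_map_prod_eq_prod_map_map hr.aemeasurable
    (measurable_pi_apply n).aemeasurable).1 hind
  have hn : Q.map (fun E : ℕ → ℝ => E n) = P := Measure.infinitePi_map_eval _ n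
  rw [hn] at hmap
  have hψ : Measurable fun p : (Finset.range n → ℝ) × ℝ => φ (j p.1) p.2 :=
    hφ.comp ((hj.comp measurable_fst).prodMk measurable_snd)
  calc ∫⁻ E, φ E (E n) ∂Q = ∫⁻ E, φ (j (r E)) (E n) ∂Q := by simp only [← hrj]
    _ = ∫⁻ p, φ (j p.1) p.2 ∂(Q.map fun E => (r E, E n)) :=
        (lintegral_map hψ (hr.prodMk (measurable_pi_apply n))).symm
    _ = ∫⁻ u, ∫⁻ e, φ (j u) e ∂P ∂(Q.map r) := by
        rw [hmap, lintegral_prod _ hψ.aemeasurable]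
    _ = ∫⁻ E, ∫⁻ e, φ (j (r E)) e ∂P ∂Q := lintegral_map hψ.lintegral_prod_right' hr
    _ = _ := by simp only [← hrj]

namespace WeightedGraph

variable {V : Type u} (Γ : WeightedGraph V)

lemma mem_nbrs {x y : V} : y ∈ Γ.nbrs x ↔ 0 < Γ.μ x y := by simp [nbrs]

lemma totalWeight_nonneg (x : V) : 0 ≤ Γ.totalWeight x :=
  Finset.sum_nonneg fun y _ => Γ.μ_nonneg x y

lemma rate_nonneg (x : V) : 0 ≤ Γ.rate x := div_nonneg (Γ.totalWeight_nonneg x) (Γ.ν_pos x).le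

lemma jumpTime_congr {ω ω' : (ℕ → V) × (ℕ → ℝ)} {n : ℕ} (h : ∀ k < n, ω.1 k = ω'.1 k)
    (h' : ∀ k < n, ω.2 k = ω'.2 k) : Γ.jumpTime ω n = Γ.jumpTime ω' n :=
  Finset.sum_congr rfl fun k hk => by
    rw [h k (Finset.mem_range.1 hk), h' k (Finset.mem_range.1 hk)]

lemma jumpTime_succ (ω : (ℕ → V) × (ℕ → ℝ)) (n : ℕ) : Γ.jumpTime ω (n + 1) =
    Γ.jumpTime ω n + ENNReal.ofReal (ω.2 n) / ENNReal.ofReal (Γ.rate (ω.1 n)) :=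
  Finset.sum_range_succ _ n

section Walk

variable [MeasurableSpace V] [DiscreteMeasurableSpace V]

instance isProbabilityMeasure_chainLaw (x : V) : IsProbabilityMeasure (Γ.chainLaw x) := by
  unfold chainLaw
  infer_instance

instance isProbabilityMeasure_P (x : V) : IsProbabilityMeasure (Γ.P x) := by
  unfold P
  infer_instance

/-- The Markov property of the jump chain. -/
lemma lintegral_chainLaw (x : V) (n : ℕ) {φ : (ℕ → V) → V → ℝ≥0∞}
    (hφ : Measurable (Function.uncurry φ))
    (hdep : ∀ Y Y' z, (∀ k ≤ n, Y k = Y' k) → φ Y z = φ Y' z) :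
    ∫⁻ Y, φ Y (Y (n + 1)) ∂Γ.chainLaw x =
      ∫⁻ Y, ∫⁻ z, φ Y z ∂Γ.jumpLaw (Y n) ∂Γ.chainLaw x := by
  let r : (ℕ → V) → ((i : Finset.Iic n) → V) := Preorder.frestrictLe (π := fun _ => V) n
  -- Later positions are irrelevant to `φ`; repeating the `n`-th one avoids choosing a base point of
  -- `V`.
  let j : ((i : Finset.Iic n) → V) → (ℕ → V) := fun u k =>
    if h : k ∈ Finset.Iic n then u ⟨k, h⟩ else u ⟨n, by simp⟩
  have hr : Measurable r := Preorder.measurable_frestrictLe n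
  have hj : Measurable j := measurable_pi_lambda _ fun k => by
    by_cases h : k ∈ Finset.Iic n
    · simp only [j, h, dif_pos]; exact measurable_pi_apply _
    · simp only [j, h]; exact measurable_pi_apply _
  have hrj : ∀ Y z, φ Y z = φ (j (r Y)) z := fun Y z => hdep _ _ _ fun k hk => by
    simp [j, r, hk]
  have hψ : Measurable fun p : ((i : Finset.Iic n) → V) × V => φ (j p.1) p.2 :=
    hφ.comp ((hj.comp measurable_fst).prodMk measurable_snd)
  set κ : Kernel ((i : Finset.Iic n) → V) V :=
    Γ.jumpKernel.comap (fun h : (i : Finset.Iic n) → V => h ⟨n, by simp⟩) (measurable_pi_apply _)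
  have hmap : (Γ.chainLaw x).map r ⊗ₘ κ = (Γ.chainLaw x).map (fun Y => (r Y, Y (n + 1))) :=
    Kernel.map_frestrictLe_trajMeasure_compProd_eq_map_trajMeasure (X := fun _ => V)
  calc ∫⁻ Y, φ Y (Y (n + 1)) ∂Γ.chainLaw x
      = ∫⁻ Y, φ (j (r Y)) (Y (n + 1)) ∂Γ.chainLaw x := by simp only [← hrj]
    _ = ∫⁻ p, φ (j p.1) p.2 ∂((Γ.chainLaw x).map fun Y => (r Y, Y (n + 1))) :=
        (lintegral_map hψ (hr.prodMk (measurable_pi_apply _))).symm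
    _ = ∫⁻ u, ∫⁻ z, φ (j u) z ∂(κ u) ∂((Γ.chainLaw x).map r) := by
        rw [← hmap, Measure.lintegral_compProd hψ]
    _ = ∫⁻ Y, ∫⁻ z, φ (j (r Y)) z ∂(κ (r Y)) ∂Γ.chainLaw x :=
        lintegral_map (hψ.lintegral_kernel_prod_right') hr
    _ = _ := by simp only [← hrj]; rfl

lemma chainLaw_ae_zero (x : V) : ∀ᵐ Y ∂Γ.chainLaw x, Y 0 = x := by
  have hm : (Γ.chainLaw x).map (Preorder.frestrictLe (π := fun _ => V) 0) =
      (Measure.dirac x).map (MeasurableEquiv.piUnique (fun _ : Finset.Iic 0 => V)).symm := by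
    unfold chainLaw Kernel.trajMeasure
    rw [Measure.map_comp _ _ (Preorder.measurable_frestrictLe 0),
      Kernel.traj_map_frestrictLe (X := fun _ => V), Kernel.partialTraj_self]
    exact Measure.id_comp
  have h1 : (Γ.chainLaw x).map (fun Y => Y 0) = Measure.dirac x := by
    have h2 : (fun Y : ℕ → V => Y 0) = (fun u : (i : Finset.Iic 0) → V => u ⟨0, by simp⟩) ∘
        (Preorder.frestrictLe (π := fun _ => V) 0) := rfl
    have hp : Measurable fun u : (i : Finset.Iic 0) → V => u ⟨0, by simp⟩ := measurable_pi_apply _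
    rw [h2, ← Measure.map_map hp (Preorder.measurable_frestrictLe 0), hm,
      Measure.map_map hp (MeasurableEquiv.measurable _)]
    exact Measure.map_id
  have h3 : ∀ᵐ y ∂(Γ.chainLaw x).map (fun Y => Y 0), y = x := by
    rw [h1]
    exact (ae_dirac_iff (p := fun y => y = x) (measurableSet_singleton x)).2 rfl
  exact ae_of_ae_map (measurable_pi_apply 0).aemeasurable h3

lemma measurable_ofReal_rate : Measurable fun x : V => ENNReal.ofReal (Γ.rate x) := .of_discrete

lemma measurable_jumpTime (n : ℕ) : Measurable fun ω => Γ.jumpTime ω n := by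
  unfold jumpTime
  refine Finset.measurable_sum _ fun k _ => Measurable.div ?_ ?_
  · exact ((measurable_pi_apply k).comp measurable_snd).ennreal_ofReal
  · exact Γ.measurable_ofReal_rate.comp ((measurable_pi_apply k).comp measurable_fst)

/-- Given the position and a function `J` of the past, the next holding time is governed by an
exponential variable and the next position by the jump law. -/
lemma lintegral_P_step (x : V) (n : ℕ) {J : (ℕ → V) × (ℕ → ℝ) → ℝ≥0∞} (hJ : Measurable J)
    (hdep : ∀ ω ω', (∀ k < n, ω.1 k = ω'.1 k) → (∀ k < n, ω.2 k = ω'.2 k) → J ω = J ω')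
    {φ : ℝ≥0∞ → V → ℝ → V → ℝ≥0∞}
    (hφ : Measurable fun p : ℝ≥0∞ × V × ℝ × V => φ p.1 p.2.1 p.2.2.1 p.2.2.2) :
    ∫⁻ ω, φ (J ω) (ω.1 n) (ω.2 n) (ω.1 (n + 1)) ∂Γ.P x =
      ∫⁻ ω, ∫⁻ z, ∫⁻ e, φ (J ω) (ω.1 n) e z ∂expMeasure 1 ∂Γ.jumpLaw (ω.1 n)
        ∂Γ.P x := by
  have hY : ∀ k, Measurable fun ω : (ℕ → V) × (ℕ → ℝ) => ω.1 k := fun k =>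
    (measurable_pi_apply k).comp measurable_fst
  have hE : ∀ k, Measurable fun ω : (ℕ → V) × (ℕ → ℝ) => ω.2 k := fun k =>
    (measurable_pi_apply k).comp measurable_snd
  have hm1 : Measurable fun ω => φ (J ω) (ω.1 n) (ω.2 n) (ω.1 (n + 1)) :=
    hφ.comp (hJ.prodMk ((hY n).prodMk ((hE n).prodMk (hY (n + 1)))))
  have hm2 : Measurable fun p : ((ℕ → V) × (ℕ → ℝ)) × V =>
      ∫⁻ e, φ (J p.1) (p.1.1 n) e p.2 ∂expMeasure 1 := by
    refine Measurable.lintegral_prod_right' (f := fun q : (((ℕ → V) × (ℕ → ℝ)) × V) × ℝ =>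
      φ (J q.1.1) (q.1.1.1 n) q.2 q.1.2) ?_
    exact hφ.comp ((hJ.comp (measurable_fst.comp measurable_fst)).prodMk
      (((hY n).comp (measurable_fst.comp measurable_fst)).prodMk
        (measurable_snd.prodMk (measurable_snd.comp measurable_fst))))
  have hm3 : Measurable fun ω : (ℕ → V) × (ℕ → ℝ) =>
      ∫⁻ e, φ (J ω) (ω.1 n) e (ω.1 (n + 1)) ∂expMeasure 1 :=
    hm2.comp (measurable_id.prodMk (hY (n + 1)))
  have hm4 : Measurable fun ω : (ℕ → V) × (ℕ → ℝ) =>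
      ∫⁻ z, ∫⁻ e, φ (J ω) (ω.1 n) e z ∂expMeasure 1 ∂Γ.jumpLaw (ω.1 n) :=
    Measurable.lintegral_kernel_prod_right' (κ := Γ.jumpKernel.comap _ (hY n)) hm2
  unfold P
  rw [lintegral_prod _ hm1.aemeasurable]
  -- The clock is integrated out first, with the whole chain frozen; then the next position, with
  -- the clocks frozen.
  have h1 : ∀ Y : ℕ → V, ∫⁻ E, φ (J (Y, E)) (Y n) (E n) (Y (n + 1))
        ∂Measure.infinitePi (fun _ : ℕ => expMeasure 1) =
      ∫⁻ E, ∫⁻ e, φ (J (Y, E)) (Y n) e (Y (n + 1)) ∂expMeasure 1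
        ∂Measure.infinitePi (fun _ : ℕ => expMeasure 1) := fun Y => by
    refine lintegral_infinitePi_apply n
      (φ := fun E e => φ (J (Y, E)) (Y n) e (Y (n + 1))) ?_ ?_
    · have hq : Measurable fun q : (ℕ → ℝ) × ℝ => (J (Y, q.1), Y n, q.2, Y (n + 1)) :=
        (hJ.comp (measurable_const.prodMk measurable_fst)).prodMk
          (measurable_const.prodMk (measurable_snd.prodMk measurable_const))
      exact hφ.comp hq
    · intro E E' e h
      rw [hdep (Y, E) (Y, E') (fun _ _ => rfl) h]
  simp only [h1]
  rw [← lintegral_prod _ hm3.aemeasurable, lintegral_prod_symm _ hm3.aemeasurable,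
    lintegral_prod_symm _ hm4.aemeasurable]
  refine lintegral_congr fun E => ?_
  refine Γ.lintegral_chainLaw x n
    (φ := fun Y z => ∫⁻ e, φ (J (Y, E)) (Y n) e z ∂expMeasure 1) ?_ ?_
  · have hq : Measurable fun q : (ℕ → V) × V => (((q.1, E), q.2) : ((ℕ → V) × (ℕ → ℝ)) × V) :=
      (measurable_fst.prodMk measurable_const).prodMk measurable_snd
    exact hm2.comp hq
  · intro Y Y' z h
    rw [hdep (Y, E) (Y', E) (fun k hk => h k hk.le) (fun _ _ => rfl),
      h n le_rfl]

end Walk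

end WeightedGraph

/-! ### Survival of exponential clocks. -/

/-- The probability that an exponential clock of rate `q` started at time `j` does not ring
before time `t`, with value `0` if `t < j`. -/
noncomputable def clockSurvival (q t : ℝ) (j : ℝ≥0∞) : ℝ≥0∞ :=
  if j ≤ ENNReal.ofReal t then ENNReal.ofReal (Real.exp (-q * (t - j.toReal))) else 0

lemma measurable_clockSurvival (q : ℝ) :
    Measurable fun p : ℝ × ℝ≥0∞ => clockSurvival q p.1 p.2 := by
  unfold clockSurvival
  refine Measurable.ite (measurableSet_le measurable_snd measurable_fst.ennreal_ofReal) ?_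
    measurable_const
  exact (Real.measurable_exp.comp
    ((measurable_fst.sub measurable_snd.ennreal_toReal).const_mul (-q))).ennreal_ofReal

lemma clockSurvival_ofReal (q : ℝ) {t j : ℝ} (hj : 0 ≤ j) (hjt : j ≤ t) :
    clockSurvival q t (ENNReal.ofReal j) = ENNReal.ofReal (Real.exp (-q * (t - j))) := by
  rw [clockSurvival, if_pos (ENNReal.ofReal_le_ofReal hjt), ENNReal.toReal_ofReal hj]

lemma clockSurvival_of_lt (q : ℝ) {t : ℝ} {j : ℝ≥0∞} (h : ENNReal.ofReal t < j) :
    clockSurvival q t j = 0 := if_neg h.not_ge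

lemma ofReal_div_ofReal_of_pos {e q : ℝ} (hq : 0 < q) :
    ENNReal.ofReal e / ENNReal.ofReal q = ENNReal.ofReal (e / q) :=
  (ENNReal.ofReal_div_of_pos hq).symm

lemma lintegral_clock_eq_survival {q : ℝ} (hq : 0 ≤ q) (t : ℝ) (ht : 0 ≤ t) (j : ℝ≥0∞) :
    ∫⁻ e, (if j ≤ ENNReal.ofReal t ∧
      ENNReal.ofReal t < j + ENNReal.ofReal e / ENNReal.ofReal q then 1 else 0) ∂expMeasure 1 =
      clockSurvival q t j := by
  rcases lt_or_ge (ENNReal.ofReal t) j with hlt | hle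
  · rw [clockSurvival_of_lt q hlt]
    simp [hlt.not_ge]
  obtain ⟨j', hj0, rfl⟩ : ∃ j' : ℝ, 0 ≤ j' ∧ j = ENNReal.ofReal j' :=
    ⟨j.toReal, ENNReal.toReal_nonneg, (ENNReal.ofReal_toReal (hle.trans_lt
      ENNReal.ofReal_lt_top).ne).symm⟩
  have hjt : j' ≤ t := (ENNReal.ofReal_le_ofReal_iff ht).1 hle
  have hqu : 0 ≤ q * (t - j') := mul_nonneg hq (by linarith)
  have hiff : ∀ e : ℝ, 0 < e → (ENNReal.ofReal t <
      ENNReal.ofReal j' + ENNReal.ofReal e / ENNReal.ofReal q ↔ q * (t - j') < e) := by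
    intro e he
    -- A clock of rate `0` never rings, since `e / 0 = ∞` in `[0, ∞]` for `e > 0`. The exceptional
    -- `0 / 0 = 0` occurs on a null set only.
    rcases hq.eq_or_lt with h0 | hpos
    · rw [← h0, zero_mul, ENNReal.ofReal_zero, ENNReal.div_zero (ENNReal.ofReal_pos.2 he).ne']
      simp [he]
    · rw [ofReal_div_ofReal_of_pos hpos, ← ENNReal.ofReal_add hj0 (by positivity),
        ENNReal.ofReal_lt_ofReal_iff (by positivity), ← sub_lt_iff_lt_add', lt_div_iff₀ hpos,
        mul_comm]
  have hmeas : Measurable fun e : ℝ => (if ENNReal.ofReal j' ≤ ENNReal.ofReal t ∧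
      ENNReal.ofReal t < ENNReal.ofReal j' + ENNReal.ofReal e / ENNReal.ofReal q
      then (1 : ℝ≥0∞) else 0) := by
    refine Measurable.ite ?_ measurable_const measurable_const
    simp only [hle, true_and]
    exact measurableSet_lt measurable_const
      (measurable_const.add (ENNReal.measurable_ofReal.div measurable_const))
  rw [lintegral_expMeasure_one hmeas, clockSurvival_ofReal q hj0 hjt, neg_mul,
    ← integral_exp_neg_Ioi, ofReal_integral_eq_lintegral_ofReal (integrableOn_exp_neg_Ioi _)
      (ae_of_all _ fun _ => (Real.exp_pos _).le), ← lintegral_indicator measurableSet_Ioi,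
    ← lintegral_indicator measurableSet_Ioi]
  refine lintegral_congr fun e => ?_
  simp only [indicator_apply, mem_Ioi, hle, true_and]
  by_cases he : 0 < e
  · simp only [he, if_true, hiff e he, mul_ite, mul_one, mul_zero]
  · have : ¬ q * (t - j') < e := by linarith
    simp [he, this]

/-- The density of the ringing time of a clock of rate `p`, integrated against the survival of a
second clock of rate `q` started then. -/
lemma lintegral_clockSurvival_add {p : ℝ} (hp : 0 ≤ p) (q : ℝ) {t : ℝ} (ht : 0 ≤ t) (j : ℝ≥0∞) :
    ∫⁻ e, clockSurvival q t (j + ENNReal.ofReal e / ENNReal.ofReal p) ∂expMeasure 1 =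
      ENNReal.ofReal p * ∫⁻ s in Ioc 0 t,
        clockSurvival p s j * ENNReal.ofReal (Real.exp (-q * (t - s))) := by
  have hmeas : Measurable fun e : ℝ =>
      clockSurvival q t (j + ENNReal.ofReal e / ENNReal.ofReal p) :=
    (measurable_clockSurvival q).comp (measurable_const.prodMk
      (measurable_const.add (ENNReal.measurable_ofReal.div measurable_const)))
  rw [lintegral_expMeasure_one hmeas]
  rcases hp.eq_or_lt with h0 | hpos
  · rw [← h0, ENNReal.ofReal_zero, zero_mul]
    refine (setLIntegral_congr_fun measurableSet_Ioi fun e he => ?_).trans lintegral_zero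
    have he' : ENNReal.ofReal e ≠ 0 := (ENNReal.ofReal_pos.2 he).ne'
    simp only [ENNReal.div_zero he', add_top]
    rw [clockSurvival_of_lt q ENNReal.ofReal_lt_top, mul_zero]
  rcases lt_or_ge (ENNReal.ofReal t) j with hlt | hle
  · have h1 : ∀ s ∈ Ioc 0 t, clockSurvival p s j * ENNReal.ofReal (Real.exp (-q * (t - s))) = 0 :=
      fun s hs => by
        rw [clockSurvival_of_lt p ((ENNReal.ofReal_le_ofReal hs.2).trans_lt hlt), zero_mul]
    rw [setLIntegral_congr_fun measurableSet_Ioc h1, lintegral_zero, mul_zero]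
    refine (setLIntegral_congr_fun measurableSet_Ioi fun e _ => ?_).trans lintegral_zero
    rw [clockSurvival_of_lt q (hlt.trans_le le_self_add), mul_zero]
  obtain ⟨j', hj0, rfl⟩ : ∃ j' : ℝ, 0 ≤ j' ∧ j = ENNReal.ofReal j' :=
    ⟨j.toReal, ENNReal.toReal_nonneg, (ENNReal.ofReal_toReal (hle.trans_lt
      ENNReal.ofReal_lt_top).ne).symm⟩
  have hjt : j' ≤ t := (ENNReal.ofReal_le_ofReal_iff ht).1 hle
  -- The substitution `e = p * (s - j')`, where `s` is the ringing time; its Jacobian is the factor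
  -- `p`.
  have himage : (fun s => p * (s - j')) '' Ioc j' t = Ioc 0 (p * (t - j')) := by
    ext e
    simp only [mem_image, mem_Ioc]
    constructor
    · rintro ⟨s, ⟨h1, h2⟩, rfl⟩
      exact ⟨mul_pos hpos (by linarith), mul_le_mul_of_nonneg_left (by linarith) hp⟩
    · rintro ⟨h1, h2⟩
      refine ⟨j' + e / p, ⟨by linarith [div_pos h1 hpos], ?_⟩, by field_simp; ring⟩
      have : e / p ≤ t - j' := by rw [div_le_iff₀ hpos]; linarith
      linarith
  have hL : ∫⁻ e in Ioi 0, ENNReal.ofReal (Real.exp (-e)) *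
      clockSurvival q t (ENNReal.ofReal j' + ENNReal.ofReal e / ENNReal.ofReal p) =
      ∫⁻ e in Ioc 0 (p * (t - j')), ENNReal.ofReal (Real.exp (-e)) *
        ENNReal.ofReal (Real.exp (-q * (t - (j' + e / p)))) := by
    rw [← lintegral_indicator measurableSet_Ioi, ← lintegral_indicator measurableSet_Ioc]
    refine lintegral_congr fun e => ?_
    simp only [indicator_apply, mem_Ioi, mem_Ioc]
    by_cases he : 0 < e
    · have he' : 0 ≤ j' + e / p := by positivity
      rw [if_pos he, ofReal_div_ofReal_of_pos hpos, ← ENNReal.ofReal_add hj0 (by positivity)]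
      by_cases h2 : e ≤ p * (t - j')
      · have h3 : e / p ≤ t - j' := by rw [div_le_iff₀ hpos]; linarith
        rw [if_pos ⟨he, h2⟩, clockSurvival_ofReal q he' (by linarith)]
      · have h3 : t - j' < e / p := by rw [lt_div_iff₀ hpos]; linarith
        rw [if_neg fun h => h2 h.2, clockSurvival_of_lt q
          ((ENNReal.ofReal_lt_ofReal_iff (by linarith)).2 (by linarith)), mul_zero]
    · rw [if_neg he, if_neg fun h => he h.1]
  have hR : ∫⁻ s in Ioc 0 t, clockSurvival p s (ENNReal.ofReal j') *
      ENNReal.ofReal (Real.exp (-q * (t - s))) = ∫⁻ s in Ioc j' t,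
        ENNReal.ofReal (Real.exp (-p * (s - j'))) * ENNReal.ofReal (Real.exp (-q * (t - s))) := by
    rw [← lintegral_indicator measurableSet_Ioc, ← lintegral_indicator measurableSet_Ioc]
    refine lintegral_congr_ae ?_
    filter_upwards [Measure.ae_ne volume j'] with s hs
    simp only [indicator_apply, mem_Ioc]
    by_cases h1 : j' < s
    · have h2 : 0 < s := hj0.trans_lt h1
      simp only [h1, h2, true_and, clockSurvival_ofReal p hj0 h1.le]
    · have h2 : s < j' := lt_of_le_of_ne (not_lt.1 h1) hs
      have h4 : ¬(j' < s ∧ s ≤ t) := fun h => h1 h.1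
      rw [if_neg h4]
      split_ifs with h3
      · rw [clockSurvival_of_lt p ((ENNReal.ofReal_lt_ofReal_iff (h3.1.trans h2 : 0 < j')).2 h2), zero_mul]
      · rfl
  rw [hL, hR, ← himage, lintegral_image_eq_lintegral_abs_deriv_mul (f' := fun _ => p)
    measurableSet_Ioc (fun s _ => ?_) (fun a _ b _ h => ?_), ← lintegral_const_mul']
  · refine setLIntegral_congr_fun measurableSet_Ioc fun s _ => ?_
    rw [abs_of_pos hpos, mul_div_cancel_left₀ _ hpos.ne', add_sub_cancel]
    simp only [neg_mul]
  · exact ENNReal.ofReal_ne_top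
  · have h := ((hasDerivAt_id s).sub_const j').const_mul p
    rw [mul_one] at h
    exact h.hasDerivWithinAt
  · have := mul_left_cancel₀ hpos.ne' h
    linarith

/-! ### The forward integral equation of the walk. -/

namespace WeightedGraph

variable {V : Type u} (Γ : WeightedGraph V)

lemma jumpTime_mono (ω : (ℕ → V) × (ℕ → ℝ)) : Monotone (Γ.jumpTime ω) :=
  monotone_nat_of_le_succ fun n => by rw [jumpTime_succ]; exact le_self_add

/-- The intervals between successive jump times are disjoint, so the least index taken by `Nat.find`
is the only one. -/
lemma X_eq_some_iff (t : ℝ) (ω : (ℕ → V) × (ℕ → ℝ)) (y : V) : Γ.X t ω = some y ↔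
    ∃ n, Γ.jumpTime ω n ≤ ENNReal.ofReal t ∧ ENNReal.ofReal t < Γ.jumpTime ω (n + 1) ∧
      ω.1 n = y := by
  classical
  unfold X
  constructor
  · intro h
    split_ifs at h with hex
    have hs := Nat.find_spec hex
    refine ⟨_, hs.1, hs.2, Option.some_injective _ h⟩
  · rintro ⟨n, h1, h2, rfl⟩
    have hex : ∃ n, Γ.jumpTime ω n ≤ ENNReal.ofReal t ∧ ENNReal.ofReal t < Γ.jumpTime ω (n + 1) :=
      ⟨n, h1, h2⟩
    rw [dif_pos hex]
    refine congrArg (fun k => some (ω.1 k)) ?_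
    rw [Nat.find_eq_iff]
    exact ⟨⟨h1, h2⟩, fun m hm h => (h.2.trans_le (Γ.jumpTime_mono ω hm)).not_ge h1⟩

open Classical in
/-- The vertices that can be reached from `x` in at most `n` jumps. -/
noncomputable def reach (x : V) : ℕ → Finset V
  | 0 => {x}
  | n + 1 => reach x n ∪ (reach x n).biUnion Γ.nbrs

lemma reach_mono (x : V) : Monotone (Γ.reach x) := by
  classical
  exact monotone_nat_of_le_succ fun n => by rw [reach]; exact Finset.subset_union_left

section Walk

variable [MeasurableSpace V] [DiscreteMeasurableSpace V]

/-- The probability that the walk from `x` is at `y` at time `t`, after exactly `n` jumps. -/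
noncomputable def occupation (n : ℕ) (t : ℝ) (x y : V) : ℝ≥0∞ :=
  Γ.P x {ω | Γ.jumpTime ω n ≤ ENNReal.ofReal t ∧ ENNReal.ofReal t < Γ.jumpTime ω (n + 1) ∧
    ω.1 n = y}

lemma measurableSet_position (n : ℕ) (y : V) :
    MeasurableSet {ω : (ℕ → V) × (ℕ → ℝ) | ω.1 n = y} := by
  have h : Measurable fun ω : (ℕ → V) × (ℕ → ℝ) => ω.1 n :=
    (measurable_pi_apply n).comp measurable_fst
  exact h (measurableSet_singleton y)

lemma measurableSet_occupation (n : ℕ) (t : ℝ) (y : V) :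
    MeasurableSet {ω | Γ.jumpTime ω n ≤ ENNReal.ofReal t ∧
      ENNReal.ofReal t < Γ.jumpTime ω (n + 1) ∧ ω.1 n = y} :=
  (measurableSet_le (Γ.measurable_jumpTime n) measurable_const).inter
    ((measurableSet_lt measurable_const (Γ.measurable_jumpTime (n + 1))).inter
      (measurableSet_position n y))

lemma transProb_eq_tsum (t : ℝ) (x y : V) :
    Γ.transProb t x y = ∑' n, Γ.occupation n t x y := by
  have h : {ω | Γ.X t ω = some y} = ⋃ n, {ω | Γ.jumpTime ω n ≤ ENNReal.ofReal t ∧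
      ENNReal.ofReal t < Γ.jumpTime ω (n + 1) ∧ ω.1 n = y} := by
    ext ω
    simp only [mem_ofPred_eq, mem_iUnion, X_eq_some_iff]
  rw [transProb, h, measure_iUnion _ (fun n => Γ.measurableSet_occupation n t y)]
  · rfl
  · refine (pairwise_disjoint_on _).2 fun m n hmn => disjoint_left.2 fun ω h1 h2 => ?_
    exact (h1.2.1.trans_le (Γ.jumpTime_mono ω hmn)).not_ge h2.1

lemma occupation_eq_lintegral (n : ℕ) {t : ℝ} (ht : 0 ≤ t) (x y : V) :
    Γ.occupation n t x y = ∫⁻ ω, {ω | ω.1 n = y}.indicator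
      (fun ω => clockSurvival (Γ.rate y) t (Γ.jumpTime ω n)) ω ∂Γ.P x := by
  classical
  have hφ : Measurable fun p : ℝ≥0∞ × V × ℝ × V => (if (p.1 ≤ ENNReal.ofReal t ∧
      ENNReal.ofReal t < p.1 + ENNReal.ofReal p.2.2.1 / ENNReal.ofReal (Γ.rate p.2.1)) ∧
      p.2.1 = y then (1 : ℝ≥0∞) else 0) := by
    refine Measurable.ite ?_ measurable_const measurable_const
    have hV : Measurable fun p : ℝ≥0∞ × V × ℝ × V => p.2.1 := by fun_prop
    refine ((measurableSet_le measurable_fst measurable_const).inter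
      (measurableSet_lt measurable_const (measurable_fst.add (Measurable.div ?_ ?_)))).inter
      (hV (measurableSet_singleton y))
    · exact ENNReal.measurable_ofReal.comp (by fun_prop)
    · exact Γ.measurable_ofReal_rate.comp hV
  have h1 := Γ.lintegral_P_step x n (Γ.measurable_jumpTime n)
    (fun ω ω' h h' => Γ.jumpTime_congr h h')
    (φ := fun j w e _ => if (j ≤ ENNReal.ofReal t ∧
      ENNReal.ofReal t < j + ENNReal.ofReal e / ENNReal.ofReal (Γ.rate w)) ∧ w = y then 1 else 0) hφ
  rw [occupation, ← lintegral_indicator_one (Γ.measurableSet_occupation n t y)]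
  refine Eq.trans (lintegral_congr fun ω => ?_) (h1.trans (lintegral_congr fun ω => ?_))
  · simp only [indicator_apply, mem_ofPred_eq, Pi.one_apply, jumpTime_succ, and_assoc]
  · rw [lintegral_const, measure_univ, mul_one]
    by_cases hy : ω.1 n = y
    · rw [indicator_of_mem (by exact hy)]
      simp only [hy, and_true]
      exact lintegral_clock_eq_survival (Γ.rate_nonneg y) t ht _
    · rw [indicator_of_notMem (by exact hy)]
      simp [hy]

lemma jumpLaw_singleton {z : V} (hz : Γ.nbrs z ≠ ∅) (y : V) :
    Γ.jumpLaw z {y} = ENNReal.ofReal (Γ.μ z y / Γ.totalWeight z) := by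
  classical
  rw [jumpLaw, if_neg hz, Measure.finsetSum_apply]
  simp only [Measure.smul_apply, Measure.dirac_apply' _ (measurableSet_singleton y), smul_eq_mul,
    indicator_apply, mem_singleton_iff, Pi.one_apply, mul_ite, mul_one, mul_zero,
    Finset.sum_ite_eq']
  split_ifs with h
  · rfl
  · have : Γ.μ z y = 0 := le_antisymm (not_lt.1 fun h' => h (Γ.mem_nbrs.2 h')) (Γ.μ_nonneg z y)
    rw [this, zero_div, ENNReal.ofReal_zero]

/-- The total weight cancels between the jump probability and the holding rate, leaving the jump
rate `μ z y / ν z`. At a vertex without neighbours both sides vanish because the rate is `0`. -/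
lemma jumpLaw_mul_lintegral (z y : V) {t : ℝ} (ht : 0 ≤ t) (j : ℝ≥0∞) :
    Γ.jumpLaw z {y} * ∫⁻ e, clockSurvival (Γ.rate y) t
      (j + ENNReal.ofReal e / ENNReal.ofReal (Γ.rate z)) ∂expMeasure 1 =
      ENNReal.ofReal (Γ.μ z y / Γ.ν z) * ∫⁻ s in Ioc 0 t, clockSurvival (Γ.rate z) s j *
        ENNReal.ofReal (Real.exp (-Γ.rate y * (t - s))) := by
  rw [lintegral_clockSurvival_add (Γ.rate_nonneg z) _ ht, ← mul_assoc]
  congr 1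
  by_cases hz : Γ.nbrs z = ∅
  · have h1 : Γ.rate z = 0 := by simp [rate, totalWeight, hz]
    have h2 : Γ.μ z y = 0 := le_antisymm (not_lt.1 fun h => by
      have := Γ.mem_nbrs.2 h; rw [hz] at this; simp at this) (Γ.μ_nonneg z y)
    simp [h1, h2]
  · rw [Γ.jumpLaw_singleton hz, ← ENNReal.ofReal_mul' (Γ.rate_nonneg z), rate]
    have hpos : 0 < Γ.totalWeight z := Finset.sum_pos (fun w hw => Γ.mem_nbrs.1 hw)
      (Finset.nonempty_iff_ne_empty.2 hz)
    rw [div_mul_div_cancel₀ hpos.ne']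

/-- The occupation probabilities satisfy the forward recursion. -/
lemma occupation_succ (n : ℕ) {t : ℝ} (ht : 0 ≤ t) (x y : V) :
    Γ.occupation (n + 1) t x y = ∑ z ∈ Γ.nbrs y, ENNReal.ofReal (Γ.μ z y / Γ.ν z) *
      ∫⁻ s in Ioc 0 t, Γ.occupation n s x z * ENNReal.ofReal (Real.exp (-Γ.rate y * (t - s))) := by
  classical
  have hφ : Measurable fun p : ℝ≥0∞ × V × ℝ × V => ({y} : Set V).indicator (fun _ =>
      clockSurvival (Γ.rate y) t
        (p.1 + ENNReal.ofReal p.2.2.1 / ENNReal.ofReal (Γ.rate p.2.1))) p.2.2.2 := by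
    have hV : Measurable fun p : ℝ≥0∞ × V × ℝ × V => p.2.1 := by fun_prop
    have hV' : Measurable fun p : ℝ≥0∞ × V × ℝ × V => p.2.2.2 := by fun_prop
    have h : Measurable fun p : ℝ≥0∞ × V × ℝ × V => clockSurvival (Γ.rate y) t
        (p.1 + ENNReal.ofReal p.2.2.1 / ENNReal.ofReal (Γ.rate p.2.1)) := by
      refine (measurable_clockSurvival _).comp (measurable_const.prodMk
        (measurable_fst.add (Measurable.div ?_ ?_)))
      · exact ENNReal.measurable_ofReal.comp (by fun_prop)
      · exact Γ.measurable_ofReal_rate.comp hV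
    exact h.indicator (hV' (measurableSet_singleton y))
  have h1 := Γ.lintegral_P_step x n (Γ.measurable_jumpTime n)
    (fun ω ω' h h' => Γ.jumpTime_congr h h')
    (φ := fun j w e z => ({y} : Set V).indicator (fun _ => clockSurvival (Γ.rate y) t
      (j + ENNReal.ofReal e / ENNReal.ofReal (Γ.rate w))) z) hφ
  have hmeas : ∀ z, Measurable fun p : ((ℕ → V) × (ℕ → ℝ)) × ℝ => {ω | ω.1 n = z}.indicator
      (fun ω => clockSurvival (Γ.rate z) p.2 (Γ.jumpTime ω n)) p.1 *
        ENNReal.ofReal (Real.exp (-Γ.rate y * (t - p.2))) := fun z => by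
    have h : Measurable fun p : ((ℕ → V) × (ℕ → ℝ)) × ℝ =>
        clockSurvival (Γ.rate z) p.2 (Γ.jumpTime p.1 n) :=
      (measurable_clockSurvival _).comp
        (measurable_snd.prodMk ((Γ.measurable_jumpTime n).comp measurable_fst))
    refine (h.indicator (measurable_fst (measurableSet_position n z))).mul ?_
    exact ENNReal.measurable_ofReal.comp (by fun_prop)
  rw [Γ.occupation_eq_lintegral (n + 1) ht]
  calc _ = ∫⁻ ω, ({y} : Set V).indicator (fun _ => clockSurvival (Γ.rate y) t
        (Γ.jumpTime ω n + ENNReal.ofReal (ω.2 n) / ENNReal.ofReal (Γ.rate (ω.1 n))))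
        (ω.1 (n + 1)) ∂Γ.P x := lintegral_congr fun ω => by
        simp only [indicator_apply, mem_ofPred_eq, mem_singleton_iff, jumpTime_succ]
    _ = ∫⁻ ω, Γ.jumpLaw (ω.1 n) {y} * ∫⁻ e, clockSurvival (Γ.rate y) t
        (Γ.jumpTime ω n + ENNReal.ofReal e / ENNReal.ofReal (Γ.rate (ω.1 n))) ∂expMeasure 1
        ∂Γ.P x := by
        refine h1.trans (lintegral_congr fun ω => ?_)
        have h2 : ∀ z, ∫⁻ e, ({y} : Set V).indicator (fun _ => clockSurvival (Γ.rate y) t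
            (Γ.jumpTime ω n + ENNReal.ofReal e / ENNReal.ofReal (Γ.rate (ω.1 n)))) z
            ∂expMeasure 1 = ({y} : Set V).indicator (fun _ => ∫⁻ e, clockSurvival (Γ.rate y) t
            (Γ.jumpTime ω n + ENNReal.ofReal e / ENNReal.ofReal (Γ.rate (ω.1 n)))
            ∂expMeasure 1) z := fun z => by
          by_cases hz : z ∈ ({y} : Set V)
          · simp only [indicator_of_mem hz]
          · simp only [indicator_of_notMem hz, lintegral_zero]
        simp only [h2]
        rw [lintegral_indicator_const (measurableSet_singleton y), mul_comm]
    _ = ∫⁻ ω, (∑ z ∈ Γ.nbrs y, ENNReal.ofReal (Γ.μ z y / Γ.ν z) *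
        (∫⁻ s in Ioc 0 t, {ω | ω.1 n = z}.indicator
          (fun ω => clockSurvival (Γ.rate z) s (Γ.jumpTime ω n)) ω *
            ENNReal.ofReal (Real.exp (-Γ.rate y * (t - s))))) ∂Γ.P x := by
        refine lintegral_congr fun ω => ?_
        rw [Γ.jumpLaw_mul_lintegral _ _ ht]
        have h3 : ∀ z, z ≠ ω.1 n → ENNReal.ofReal (Γ.μ z y / Γ.ν z) *
            ∫⁻ s in Ioc 0 t, {ω | ω.1 n = z}.indicator
              (fun ω => clockSurvival (Γ.rate z) s (Γ.jumpTime ω n)) ω *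
                ENNReal.ofReal (Real.exp (-Γ.rate y * (t - s))) = 0 := fun z hz => by
          have : ω ∉ {ω : (ℕ → V) × (ℕ → ℝ) | ω.1 n = z} := fun h => hz h.symm
          simp only [indicator_of_notMem this, zero_mul, lintegral_zero, mul_zero]
        -- Only the actual position before the jump contributes; if it is not a neighbour of `y`,
        -- its edge weight to `y` is `0`.
        rw [Finset.sum_eq_single (ω.1 n) (fun z _ hz => h3 z hz) (fun hn => ?_)]
        · have : ω ∈ {ω' : (ℕ → V) × (ℕ → ℝ) | ω'.1 n = ω.1 n} := rfl
          simp only [indicator_of_mem this]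
        · have : Γ.μ (ω.1 n) y = 0 := le_antisymm (not_lt.1 fun h => hn (Γ.mem_nbrs.2
            (by rwa [Γ.μ_symm]))) (Γ.μ_nonneg _ _)
          rw [this, zero_div, ENNReal.ofReal_zero, zero_mul]
    _ = _ := by
        rw [lintegral_finsetSum]
        · refine Finset.sum_congr rfl fun z _ => ?_
          rw [lintegral_const_mul' _ _ ENNReal.ofReal_ne_top,
            lintegral_lintegral_swap (hmeas z).aemeasurable]
          congr 1
          refine setLIntegral_congr_fun measurableSet_Ioc fun s hs => ?_
          rw [lintegral_mul_const' _ _ ENNReal.ofReal_ne_top,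
            Γ.occupation_eq_lintegral n hs.1.le]
        · intro z _
          exact (hmeas z).lintegral_prod_right'.const_mul _

lemma occupation_zero {t : ℝ} (ht : 0 ≤ t) (x y : V) [Decidable (x = y)] :
    Γ.occupation 0 t x y =
      if x = y then ENNReal.ofReal (Real.exp (-Γ.rate y * t)) else 0 := by
  rw [Γ.occupation_eq_lintegral 0 ht]
  have h0 : ∀ᵐ ω ∂Γ.P x, ω.1 0 = x := by
    unfold P
    exact Measure.quasiMeasurePreserving_fst.ae (Γ.chainLaw_ae_zero x)
  have h1 : ∀ᵐ ω ∂Γ.P x, {ω | ω.1 0 = y}.indicator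
      (fun ω => clockSurvival (Γ.rate y) t (Γ.jumpTime ω 0)) ω =
      if x = y then ENNReal.ofReal (Real.exp (-Γ.rate y * t)) else 0 := by
    filter_upwards [h0] with ω hω
    by_cases hxy : x = y
    · rw [if_pos hxy, indicator_of_mem (show ω ∈ {ω | ω.1 0 = y} from hω.trans hxy)]
      simp [jumpTime, clockSurvival]
    · rw [if_neg hxy, indicator_of_notMem
        (show ω ∉ {ω | ω.1 0 = y} from fun h => hxy (hω.symm.trans h))]
  rw [lintegral_congr_ae h1, lintegral_const, measure_univ, mul_one]

lemma aemeasurable_occupation (n : ℕ) (x y : V) (t : ℝ) :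
    AEMeasurable (fun s => Γ.occupation n s x y) (volume.restrict (Ioc 0 t)) := by
  have h1 : Measurable fun p : ℝ × ((ℕ → V) × (ℕ → ℝ)) =>
      clockSurvival (Γ.rate y) p.1 (Γ.jumpTime p.2 n) :=
    (measurable_clockSurvival _).comp
      (measurable_fst.prodMk ((Γ.measurable_jumpTime n).comp measurable_snd))
  have h2 : Measurable fun s : ℝ => ∫⁻ ω, {ω | ω.1 n = y}.indicator
      (fun ω => clockSurvival (Γ.rate y) s (Γ.jumpTime ω n)) ω ∂Γ.P x :=
    Measurable.lintegral_prod_right' (f := fun p : ℝ × ((ℕ → V) × (ℕ → ℝ)) =>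
      {ω | ω.1 n = y}.indicator (fun ω => clockSurvival (Γ.rate y) p.1 (Γ.jumpTime ω n)) p.2)
      (h1.indicator (measurable_snd (measurableSet_position n y)))
  refine h2.aemeasurable.congr ?_
  filter_upwards [ae_restrict_mem measurableSet_Ioc] with s hs
  rw [Γ.occupation_eq_lintegral n hs.1.le]

/-- The forward integral equation of the transition probabilities. -/
lemma transProb_eq {t : ℝ} (ht : 0 ≤ t) (x y : V) [Decidable (x = y)] :
    Γ.transProb t x y = (if x = y then ENNReal.ofReal (Real.exp (-Γ.rate y * t)) else 0) +
      ∑ z ∈ Γ.nbrs y, ENNReal.ofReal (Γ.μ z y / Γ.ν z) *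
        ∫⁻ s in Ioc 0 t, Γ.transProb s x z * ENNReal.ofReal (Real.exp (-Γ.rate y * (t - s))) := by
  rw [transProb_eq_tsum, tsum_eq_zero_add' ENNReal.summable, Γ.occupation_zero ht]
  congr 1
  simp only [Γ.occupation_succ _ ht, transProb_eq_tsum, ← ENNReal.tsum_mul_right]
  rw [Summable.tsum_finsetSum fun _ _ => ENNReal.summable]
  refine Finset.sum_congr rfl fun z _ => ?_
  rw [ENNReal.tsum_mul_left, lintegral_tsum fun n => ?_]
  exact (Γ.aemeasurable_occupation n x z t).mul
    (ENNReal.measurable_ofReal.comp (by fun_prop)).aemeasurable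

/-- The forward integral equation of the probabilities of being at `y` after fewer than `N`
jumps. -/
lemma sum_occupation_succ (N : ℕ) {t : ℝ} (ht : 0 ≤ t) (x y : V) [Decidable (x = y)] :
    ∑ n ∈ Finset.range (N + 1), Γ.occupation n t x y =
      (if x = y then ENNReal.ofReal (Real.exp (-Γ.rate y * t)) else 0) +
      ∑ z ∈ Γ.nbrs y, ENNReal.ofReal (Γ.μ z y / Γ.ν z) * ∫⁻ s in Ioc 0 t,
        (∑ n ∈ Finset.range N, Γ.occupation n s x z) *
          ENNReal.ofReal (Real.exp (-Γ.rate y * (t - s))) := by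
  rw [Finset.sum_range_succ', Γ.occupation_zero ht, add_comm]
  congr 1
  simp only [Γ.occupation_succ _ ht, Finset.sum_mul]
  rw [Finset.sum_comm]
  refine Finset.sum_congr rfl fun z _ => ?_
  rw [← Finset.mul_sum, lintegral_finsetSum' _ fun n _ => ?_]
  exact (Γ.aemeasurable_occupation n x z t).mul
    (ENNReal.measurable_ofReal.comp (by fun_prop)).aemeasurable

lemma mem_reach_of_occupation_ne_zero (n : ℕ) {t : ℝ} (ht : 0 ≤ t) (x y : V)
    (h : Γ.occupation n t x y ≠ 0) : y ∈ Γ.reach x n := by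
  classical
  induction n generalizing t y with
  | zero =>
    rw [Γ.occupation_zero ht] at h
    by_contra hy
    rw [reach, Finset.mem_singleton] at hy
    exact h (if_neg fun h' => hy h'.symm)
  | succ n ih =>
    rw [Γ.occupation_succ n ht] at h
    obtain ⟨z, hz, hne⟩ := Finset.exists_ne_zero_of_sum_ne_zero h
    have hmem : z ∈ Γ.reach x n := by
      by_contra hzn
      refine hne ?_
      rw [setLIntegral_congr_fun (g := fun _ => 0) measurableSet_Ioc fun s hs => ?_,
        lintegral_zero, mul_zero]
      have h0 : Γ.occupation n s x z = 0 := by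
        by_contra hs'
        exact hzn (ih hs.1.le z hs')
      simp only [h0, zero_mul]
    rw [reach, Finset.mem_union, Finset.mem_biUnion]
    refine Or.inr ⟨z, hmem, Γ.mem_nbrs.2 ?_⟩
    rw [Γ.μ_symm]
    exact Γ.mem_nbrs.1 hz

end Walk

end WeightedGraph

/-! ### Minimality of the killed kernel. -/

namespace KilledNetwork

variable {ι : Type*} [Fintype ι] [DecidableEq ι] (N : KilledNetwork ι)

/-- Duhamel's formula with integrals in `[0, ∞]`. -/
lemma ofReal_heat_eq {t : ℝ} (ht : 0 ≤ t) (x y : ι) :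
    ENNReal.ofReal (N.heat t x y) =
      (if x = y then ENNReal.ofReal (Real.exp (-(N.m y / N.ν y) * t)) else 0) +
      ∑ z, ENNReal.ofReal (N.μ z y / N.ν z) * ∫⁻ s in Ioc 0 t, ENNReal.ofReal (N.heat s x z) *
        ENNReal.ofReal (Real.exp (-(N.m y / N.ν y) * (t - s))) := by
  have hint : ∀ z, ENNReal.ofReal (∫ s in (0 : ℝ)..t, N.heat s x z *
      Real.exp (-(N.m y / N.ν y) * (t - s))) = ∫⁻ s in Ioc 0 t, ENNReal.ofReal (N.heat s x z) *
        ENNReal.ofReal (Real.exp (-(N.m y / N.ν y) * (t - s))) := fun z => by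
    have hc : Continuous fun s => N.heat s x z * Real.exp (-(N.m y / N.ν y) * (t - s)) :=
      (N.continuous_heat_apply x z).mul (by fun_prop)
    rw [intervalIntegral.integral_of_le ht, ofReal_integral_eq_lintegral_ofReal
      (hc.integrableOn_Ioc)]
    · exact setLIntegral_congr_fun measurableSet_Ioc fun s hs =>
        ENNReal.ofReal_mul (N.heat_nonneg hs.1.le x z)
    · filter_upwards [ae_restrict_mem measurableSet_Ioc] with s hs
      exact mul_nonneg (N.heat_nonneg hs.1.le x z) (Real.exp_pos _).le
  have hnn : ∀ z, 0 ≤ N.μ z y / N.ν z := fun z => div_nonneg (N.μ_nonneg z y) (N.ν_pos z).le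
  have hnn' : ∀ z, 0 ≤ ∫ s in (0 : ℝ)..t, N.heat s x z *
      Real.exp (-(N.m y / N.ν y) * (t - s)) := fun z =>
    intervalIntegral.integral_nonneg ht fun s hs =>
      mul_nonneg (N.heat_nonneg hs.1 x z) (Real.exp_pos _).le
  rw [N.heat_apply_eq, ENNReal.ofReal_add (by positivity)
    (Finset.sum_nonneg fun z _ => mul_nonneg (hnn z) (hnn' z)),
    ENNReal.ofReal_sum_of_nonneg fun z _ => mul_nonneg (hnn z) (hnn' z)]
  congr 1
  · split_ifs <;> simp
  · exact Finset.sum_congr rfl fun z _ => by rw [ENNReal.ofReal_mul (hnn z), hint]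

/-- The transition matrix is the smallest solution of Duhamel's formula. -/
lemma ofReal_heat_le_of_supersolution (x : ι) {F : ℝ → ι → ℝ≥0∞}
    (hF : ∀ t y, 0 ≤ t →
      (if x = y then ENNReal.ofReal (Real.exp (-(N.m y / N.ν y) * t)) else 0) +
      ∑ z, ENNReal.ofReal (N.μ z y / N.ν z) * ∫⁻ s in Ioc 0 t, F s z *
        ENNReal.ofReal (Real.exp (-(N.m y / N.ν y) * (t - s))) ≤ F t y)
    {t : ℝ} (ht : 0 ≤ t) (y : ι) : ENNReal.ofReal (N.heat t x y) ≤ F t y := by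
  have hB : ∀ z y, 0 ≤ N.μ z y / N.ν z := fun z y => div_nonneg (N.μ_nonneg z y) (N.ν_pos z).le
  have hq : ∀ y, 0 ≤ N.m y / N.ν y := fun y => div_nonneg
    ((Finset.sum_nonneg fun w _ => N.μ_nonneg y w).trans (N.sum_le y)) (N.ν_pos y).le
  set C := ∑ y, ∑ z, N.μ z y / N.ν z with hC
  have hBC : ∀ y, ∑ z, N.μ z y / N.ν z ≤ C := fun y =>
    Finset.single_le_sum (f := fun y => ∑ z, N.μ z y / N.ν z)
      (fun y _ => Finset.sum_nonneg fun z _ => hB z y) (Finset.mem_univ y)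
  have hC0 : 0 ≤ C := Finset.sum_nonneg fun y _ => Finset.sum_nonneg fun z _ => hB z y
  obtain ⟨M, hM⟩ : ∃ M, ∀ s ∈ Icc 0 t, ∀ z, N.heat s x z ≤ M := by
    have h : ∀ z, ∃ M, ∀ s ∈ Icc 0 t, N.heat s x z ≤ M := fun z => by
      obtain ⟨M, hM⟩ := isCompact_Icc.bddAbove_image (N.continuous_heat_apply x z).continuousOn
        (K := Icc 0 t)
      exact ⟨M, fun s hs => hM (mem_image_of_mem _ hs)⟩
    choose M hM using h
    refine ⟨∑ z, |M z|, fun s hs z => ((hM z s hs).trans (le_abs_self _)).trans ?_⟩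
    exact Finset.single_le_sum (f := fun z => |M z|) (fun _ _ => abs_nonneg _) (Finset.mem_univ z)
  have hM0 : 0 ≤ M := (N.heat_nonneg le_rfl x x).trans (hM 0 ⟨le_rfl, ht⟩ x)
  -- A Gronwall argument without subtraction, since `F` may be infinite. With the weight `exp (2 * C
  -- * s)`, where `C` bounds the total incoming rate at each vertex, each use of Duhamel's formula
  -- halves the error.
  have key : ∀ n : ℕ, ∀ s ∈ Icc 0 t, ∀ y, ENNReal.ofReal (N.heat s x y) ≤
      F s y + ENNReal.ofReal (M / 2 ^ n * Real.exp (2 * C * s)) := by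
    intro n
    induction n with
    | zero =>
      intro s hs y
      refine le_add_left (ENNReal.ofReal_le_ofReal ?_)
      rw [pow_zero, div_one]
      exact (hM s hs y).trans (le_mul_of_one_le_right hM0
        (Real.one_le_exp (mul_nonneg (by positivity) hs.1)))
    | succ n ih =>
      intro s hs y
      set r := M / 2 ^ n
      have hr : 0 ≤ r := by positivity
      have hmeas : Measurable fun u : ℝ => ENNReal.ofReal (r * Real.exp (2 * C * u)) := by fun_prop
      have hint : ENNReal.ofReal C * ∫⁻ u in Ioc 0 s, ENNReal.ofReal (r * Real.exp (2 * C * u)) ≤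
          ENNReal.ofReal (M / 2 ^ (n + 1) * Real.exp (2 * C * s)) := by
        have hc : Continuous fun u : ℝ => C * (r * Real.exp (2 * C * u)) := by fun_prop
        rw [← lintegral_const_mul _ hmeas]
        have h1 : ∀ u, ENNReal.ofReal C * ENNReal.ofReal (r * Real.exp (2 * C * u)) =
            ENNReal.ofReal (C * (r * Real.exp (2 * C * u))) := fun u =>
          (ENNReal.ofReal_mul hC0).symm
        simp only [h1]
        rw [← ofReal_integral_eq_lintegral_ofReal hc.integrableOn_Ioc
          (ae_of_all _ fun u => by positivity), ← intervalIntegral.integral_of_le hs.1]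
        refine ENNReal.ofReal_le_ofReal ?_
        have hd : ∀ u ∈ uIcc 0 s, HasDerivAt (fun u => r / 2 * Real.exp (2 * C * u))
            (C * (r * Real.exp (2 * C * u))) u := fun u _ => by
          have h2 := (((hasDerivAt_id u).const_mul (2 * C)).exp).const_mul (r / 2)
          refine h2.congr_deriv ?_
          simp only [id, mul_one]
          ring
        rw [intervalIntegral.integral_eq_sub_of_hasDerivAt hd (hc.intervalIntegrable _ _)]
        have h3 : M / 2 ^ (n + 1) = r / 2 := by rw [pow_succ, ← div_div]
        rw [h3]
        have : 0 ≤ r / 2 * Real.exp (2 * C * 0) := by positivity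
        linarith
      rw [N.ofReal_heat_eq hs.1]
      calc _ ≤ (if x = y then ENNReal.ofReal (Real.exp (-(N.m y / N.ν y) * s)) else 0) +
            ∑ z, ENNReal.ofReal (N.μ z y / N.ν z) * (∫⁻ u in Ioc 0 s, (F u z *
              ENNReal.ofReal (Real.exp (-(N.m y / N.ν y) * (s - u))) +
              ENNReal.ofReal (r * Real.exp (2 * C * u)))) := by
            refine add_le_add le_rfl (Finset.sum_le_sum fun z _ => mul_le_mul_right ?_ _)
            refine setLIntegral_mono' measurableSet_Ioc fun u hu => ?_
            refine (mul_le_mul_left (ih u ⟨hu.1.le, hu.2.trans hs.2⟩ z) _).trans ?_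
            rw [add_mul]
            refine add_le_add le_rfl (mul_le_of_le_one_right zero_le ?_)
            rw [ENNReal.ofReal_le_one, Real.exp_le_one_iff, neg_mul, neg_nonpos]
            exact mul_nonneg (hq y) (by linarith [hu.2])
        _ = ((if x = y then ENNReal.ofReal (Real.exp (-(N.m y / N.ν y) * s)) else 0) +
            ∑ z, ENNReal.ofReal (N.μ z y / N.ν z) * ∫⁻ u in Ioc 0 s, F u z *
              ENNReal.ofReal (Real.exp (-(N.m y / N.ν y) * (s - u)))) +
            (∑ z, ENNReal.ofReal (N.μ z y / N.ν z)) *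
              ∫⁻ u in Ioc 0 s, ENNReal.ofReal (r * Real.exp (2 * C * u)) := by
            rw [add_assoc, Finset.sum_mul, ← Finset.sum_add_distrib]
            congr 1
            refine Finset.sum_congr rfl fun z _ => ?_
            rw [lintegral_add_right _ hmeas, mul_add]
        _ ≤ _ := by
            refine add_le_add (hF s y hs.1) (le_trans (mul_le_mul_left ?_ _) hint)
            rw [← ENNReal.ofReal_sum_of_nonneg fun z _ => hB z y]
            exact ENNReal.ofReal_le_ofReal (hBC y)
  have hlim : Filter.Tendsto (fun n : ℕ => F t y +
      ENNReal.ofReal (M / 2 ^ n * Real.exp (2 * C * t))) Filter.atTop (nhds (F t y + 0)) := by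
    refine Filter.Tendsto.const_add _ ?_
    rw [← ENNReal.ofReal_zero]
    refine ENNReal.tendsto_ofReal ?_
    have h := ((tendsto_pow_atTop_nhds_zero_of_lt_one (r := (1 / 2 : ℝ)) (by norm_num)
      (by norm_num)).const_mul M).mul_const (Real.exp (2 * C * t))
    rw [mul_zero, zero_mul] at h
    refine h.congr fun n => ?_
    rw [one_div, inv_pow, div_eq_mul_inv]
  rw [add_zero] at hlim
  exact ge_of_tendsto' hlim fun n => key n t ⟨ht, le_rfl⟩ y

end KilledNetwork

/-! ### Comparison of the walk with its killed versions. -/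

namespace WeightedGraph

variable {V : Type u} (Γ : WeightedGraph V)

lemma sum_le_sum_nbrs (z : V) (U : Finset V) {g : V → ℝ} (hg : ∀ w, 0 ≤ g w)
    (hg' : ∀ w, Γ.μ z w = 0 → g w = 0) : ∑ w : U, g w ≤ ∑ w ∈ Γ.nbrs z, g w := by
  classical
  rw [Finset.sum_coe_sort U g, ← Finset.sum_filter_ne_zero]
  refine Finset.sum_le_sum_of_subset_of_nonneg (fun w hw => ?_) fun w _ _ => hg w
  rw [Finset.mem_filter] at hw
  exact Γ.mem_nbrs.2 (lt_of_le_of_ne (Γ.μ_nonneg z w) fun h => hw.2 (hg' w h.symm))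

/-- The walk killed when it leaves `U`. -/
noncomputable def killed (U : Finset V) : KilledNetwork U where
  μ z w := Γ.μ z w
  ν z := Γ.ν z
  m z := Γ.totalWeight z
  μ_symm z w := Γ.μ_symm z w
  μ_nonneg z w := Γ.μ_nonneg z w
  ν_pos z := Γ.ν_pos z
  sum_le z := Γ.sum_le_sum_nbrs z U (g := fun w => Γ.μ z w) (fun w => Γ.μ_nonneg z w) fun _ h => h

lemma IsAdapted.isAdaptedFun_dist {Γ : WeightedGraph V} [MetricSpace V] (h : Γ.IsAdapted)
    (U : Finset V) (x : V) : (Γ.killed U).IsAdaptedFun fun z => dist x z where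
  abs_sub_le z w hzw := by
    refine le_trans ?_ (h.dist_le_one z w hzw)
    rw [dist_comm x, dist_comm x]
    exact abs_dist_sub_le _ _ _
  sum_le z := by
    have h1 := h.sum_le_one z
    rw [one_div, inv_mul_le_iff₀ (Γ.ν_pos z), mul_one] at h1
    refine le_trans ?_ h1
    refine le_trans (Γ.sum_le_sum_nbrs z U (g := fun w => (dist x z - dist x w) ^ 2 * Γ.μ z w)
      (fun w => mul_nonneg (sq_nonneg _) (Γ.μ_nonneg z w)) fun w hw => by rw [hw, mul_zero]) ?_
    refine Finset.sum_le_sum fun w _ => mul_le_mul_of_nonneg_right ?_ (Γ.μ_nonneg z w)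
    rw [← sq_abs]
    refine pow_le_pow_left₀ (abs_nonneg _) ?_ 2
    rw [dist_comm x, dist_comm x]
    exact abs_dist_sub_le _ _ _

section Walk

variable [MeasurableSpace V] [DiscreteMeasurableSpace V]

open Classical in
lemma ofReal_heat_killed_le_transProb (U : Finset V) {t : ℝ} (ht : 0 ≤ t) (x y : U) :
    ENNReal.ofReal ((Γ.killed U).heat t x y) ≤ Γ.transProb t x y := by
  refine (Γ.killed U).ofReal_heat_le_of_supersolution x (F := fun t y => Γ.transProb t x y)
    (fun t y ht => ?_) ht y
  rw [Γ.transProb_eq ht]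
  refine add_le_add ?_ ?_
  · simp only [Subtype.ext_iff]; exact le_rfl
  · refine (Finset.sum_coe_sort U fun z => ENNReal.ofReal (Γ.μ z y / Γ.ν z) *
      ∫⁻ s in Ioc 0 t, Γ.transProb s x z *
        ENNReal.ofReal (Real.exp (-Γ.rate y * (t - s)))).trans_le ?_
    -- Killing keeps the total rate at each vertex, so the two formulas differ only by the
    -- nonnegative terms of neighbours outside `U`.
    refine Finset.sum_le_sum_of_ne_zero fun z _ hz => Γ.mem_nbrs.2 ?_
    refine lt_of_le_of_ne (Γ.μ_nonneg y z) fun h => hz ?_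
    rw [Γ.μ_symm z y, ← h, zero_div, ENNReal.ofReal_zero, zero_mul]

-- Induction on the number of jumps through the two forward equations. The last position before a
-- jump is still in `reach x N ⊆ U`, so no contribution is lost by restricting the sum to `U`.
open Classical in
lemma sum_occupation_le_heat {x : V} {N : ℕ} {U : Finset V} (hU : Γ.reach x N ⊆ U) (hx : x ∈ U)
    {n : ℕ} (hn : n ≤ N) {t : ℝ} (ht : 0 ≤ t) (y : U) :
    ∑ k ∈ Finset.range n, Γ.occupation k t x y ≤
      ENNReal.ofReal ((Γ.killed U).heat t ⟨x, hx⟩ y) := by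
  induction n generalizing t y with
  | zero => simp
  | succ n ih =>
    rw [Γ.sum_occupation_succ n ht, KilledNetwork.ofReal_heat_eq _ ht]
    refine add_le_add ?_ ?_
    · simp only [Subtype.ext_iff]; exact le_rfl
    calc _ ≤ ∑ z ∈ U, ENNReal.ofReal (Γ.μ z y / Γ.ν z) * ∫⁻ s in Ioc 0 t,
          (∑ n ∈ Finset.range n, Γ.occupation n s x z) *
          ENNReal.ofReal (Real.exp (-Γ.rate y * (t - s))) := by
          refine Finset.sum_le_sum_of_ne_zero fun z _ hz => ?_
          by_contra hzU
          refine hz ?_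
          rw [setLIntegral_congr_fun (g := fun _ => 0) measurableSet_Ioc fun s hs => ?_,
            lintegral_zero, mul_zero]
          have h0 : ∑ n ∈ Finset.range n, Γ.occupation n s x z = 0 :=
            Finset.sum_eq_zero fun k hk => by
              by_contra hne
              exact hzU (hU (Γ.reach_mono x (by have := Finset.mem_range.1 hk; omega)
                (Γ.mem_reach_of_occupation_ne_zero k hs.1.le x z hne)))
          simp only [h0, zero_mul]
      _ = ∑ z : U, ENNReal.ofReal (Γ.μ z y / Γ.ν z) * ∫⁻ s in Ioc 0 t,
          (∑ n ∈ Finset.range n, Γ.occupation n s x z) *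
          ENNReal.ofReal (Real.exp (-Γ.rate y * (t - s))) :=
          (Finset.sum_coe_sort U _).symm
      _ ≤ _ := by
          refine Finset.sum_le_sum fun z _ => mul_le_mul_right ?_ _
          refine setLIntegral_mono' measurableSet_Ioc fun s hs => mul_le_mul_left ?_ _
          exact ih (by omega) hs.1.le z

open Classical in
/-- The transition probabilities are bounded by any common bound of those of the killed walks. -/
lemma transProb_le_of_heat_killed_le {t : ℝ} (ht : 0 ≤ t) (x y : V) {b : ℝ≥0∞}
    (hb : ∀ (U : Finset V) (hx : x ∈ U) (hy : y ∈ U),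
      ENNReal.ofReal ((Γ.killed U).heat t ⟨x, hx⟩ ⟨y, hy⟩) ≤ b) :
    Γ.transProb t x y ≤ b := by
  rw [transProb_eq_tsum, ENNReal.tsum_eq_iSup_nat]
  refine iSup_le fun N => ?_
  set U := Γ.reach x N ∪ {x, y}
  have hx : x ∈ U := by simp [U]
  have hy : y ∈ U := by simp [U]
  exact (Γ.sum_occupation_le_heat (U := U) Finset.subset_union_left hx le_rfl ht ⟨y, hy⟩).trans
    (hb U hx hy)

end Walk

end WeightedGraph

/-! ### The theorem. -/

/-- The quotients are taken in `[0, ∞]`, so that `1 / 0 = ∞` and a positive number over `0` is `∞`. -/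
theorem theorem1p2 :
    ∃ C₁ θ : ℝ, 0 < C₁ ∧ 0 < θ ∧
      ∀ (V : Type u) [MetricSpace V] [MeasurableSpace V] [DiscreteMeasurableSpace V]
        (Γ : WeightedGraph V) (_hd : Γ.IsAdapted) (x : Fin 2 → V) (f : Fin 2 → ℝ → ℝ)
        (_hf : ∀ i t, 0 ≤ t → 0 ≤ f i t)
        (_hdiag : ∀ i t, 0 ≤ t → Γ.transProb t (x i) (x i) ≤ 1 / ENNReal.ofReal (f i t))
        (A γ δ T₁ : ℝ) (T₂ : EReal) (_hA : 1 ≤ A) (_hγ : 1 < γ) (_hδ : 1 ≤ δ) (_hT₁ : 0 ≤ T₁)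
        (_hreg : ∀ i, IsRegularOn A γ (f i) T₁ T₂)
        (_hexp : ∀ i (t : ℝ), T₁ ≤ t → (t : EReal) < T₂ → f i t ≤ A * Real.exp (δ * t))
        (t : ℝ),
        max (8 * (alphaConst γ δ)⁻¹ ^ 2 * T₁ ^ 2) (dist (x 0) (x 1)) ≤ t → (t : EReal) < T₂ →
        Γ.transProb t (x 0) (x 1) ≤
          ENNReal.ofReal (C₁ * A ^ betaConst γ * √(Γ.ν (x 1) / Γ.ν (x 0))) /
            ENNReal.ofReal (√(f 0 (alphaConst γ δ * t) * f 1 (alphaConst γ δ * t))) *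
          ENNReal.ofReal (Real.exp (-θ * (dist (x 0) (x 1) ^ 2 / t))) := by
  classical
  refine ⟨6, 1 / 36864, by norm_num, by norm_num, ?_⟩
  intro V _ _ _ Γ hd x f hf hdiag A γ δ T₁ T₂ hA hγ hδ hT₁ hreg hexp t ht htT
  have ht0 : 0 ≤ t := dist_nonneg.trans ((le_max_right _ _).trans ht)
  refine Γ.transProb_le_of_heat_killed_le ht0 _ _ fun U hx0 hx1 => ?_
  have hxU : ∀ i, x i ∈ U := fun i => by fin_cases i; exacts [hx0, hx1]
  have hdiagU : ∀ i s, 0 ≤ s →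
      (Γ.killed U).heat s ⟨x i, hxU i⟩ ⟨x i, hxU i⟩ * f i s ≤ 1 := by
    intro i s hs
    have h1 := (Γ.ofReal_heat_killed_le_transProb U hs ⟨x i, hxU i⟩ ⟨x i, hxU i⟩).trans
      (hdiag i s hs)
    rcases (hf i s hs).eq_or_lt with h0 | hpos
    · rw [← h0, mul_zero]; exact zero_le_one
    rw [one_div, ← ENNReal.ofReal_inv_of_pos hpos,
      ENNReal.ofReal_le_ofReal_iff (inv_pos.2 hpos).le] at h1
    exact (le_inv_mul_iff₀' hpos).1 (by simpa using h1)
  -- The radial functions are the distances in `V` to the two points, restricted to `U`; the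
  -- triangle inequality makes their sum at least `D`.
  have hmain := KilledNetwork.heat_mul_sqrt_le (N := Γ.killed U)
    (x := fun i => ⟨x i, hxU i⟩) (ρ := fun i z => dist (x i) z)
    (fun i => hd.isAdaptedFun_dist U (x i)) (fun i => dist_self _) (D := dist (x 0) (x 1))
    dist_nonneg (fun z => by rw [dist_comm (x 1)]; exact dist_triangle _ _ _) hf hdiagU hA hγ hδ
    hT₁ hreg hexp ((le_max_left _ _).trans ht) ((le_max_right _ _).trans ht) htT
  set S := √(f 0 (alphaConst γ δ * t) * f 1 (alphaConst γ δ * t))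
  have hK : 0 < 6 * A ^ betaConst γ * √(Γ.ν (x 1) / Γ.ν (x 0)) :=
    mul_pos (by positivity) (Real.sqrt_pos.2 (div_pos (Γ.ν_pos _) (Γ.ν_pos _)))
  rcases (Real.sqrt_nonneg _ : 0 ≤ S).eq_or_lt with h0 | hpos
  · have : S = 0 := h0.symm
    rw [this, ENNReal.ofReal_zero, ENNReal.div_zero (ENNReal.ofReal_pos.2 hK).ne',
      ENNReal.top_mul (ENNReal.ofReal_pos.2 (Real.exp_pos _)).ne']
    exact le_top
  · rw [← ENNReal.ofReal_div_of_pos hpos, ← ENNReal.ofReal_mul (by positivity)]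
    refine ENNReal.ofReal_le_ofReal ?_
    rw [div_mul_eq_mul_div, le_div_iff₀ hpos]
    exact hmain
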